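/- **Theorem (AdaGrad with dependent data).** *Setting.* Let $\Theta\subseteq\mathbb R^p$ be closed and convex, let $0<\rho<\hat\rho$, and let $f:\Theta\to\mathbb R$ be $\rho$-weakly convex, i.e. $f+\frac\rho2\|\cdot\|^2$ is convex on $\Theta$, with $|f|\le C_\varphi$ on $\Theta$, $C_\varphi\in(0,\infty)$. Let $\pi$ be a probability distribution on a sample space $\mathcal X$, and let $G(\theta,\mathbf x)\in\mathbb R^p$ ($\theta\in\Theta$, $\mathbf x\in\mathcal X$) be measurable in $\mathbf x$ and satisfy, for all $\theta,\theta'\in\Theta$ and $\mathbf x\in\mathcal X$, $$\mathbb E_{\mathbf x\sim\pi}[G(\theta,\mathbf x)]\in\partial f(\theta),\qquad \|G(\theta,\mathbf x)-G(\theta',\mathbf x)\|\le L_1\|\theta-\theta'\|,\qquad \|G(\theta,\mathbf x)\|\le L ,$$ with $L,L_1\in(0,\infty)$, where $\partial f(\theta)$ is the set of $w$ with $f(\theta')-f(\theta)\ge\langle w,\theta'-\theta\rangle+o(\|\theta'-\theta\|)$ as $\theta'\to\theta$ in $\Theta$. Put $\varphi=f+\iota_\Theta$ and let $\varphi_{1/\hat\rho}(\theta)=\min_{\theta'\in\Theta}\big(f(\theta')+\frac{\hat\rho}2\|\theta'-\theta\|^2\big)$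 be its Moreau envelope. *Sampling.* Samples $\mathbf x_1,\mathbf x_2,\dots$ are drawn successively, $\mathbf x_{n+1}$ from a conditional distribution $\pi_{n+1}(\cdot\mid\mathbf x_1,\dots,\mathbf x_n)$. For $m<n$ let $$\Delta_{[m,n]}=\sup_{\mathbf x_1,\dots,\mathbf x_m\in\mathcal X}\|\pi_n(\cdot\mid\mathbf x_1,\dots,\mathbf x_m)-\pi\|_{TV},\qquad \|\mu-\nu\|_{TV}=\sup_A|\mu(A)-\nu(A)|,$$ where $\pi_n(\cdot\mid\mathbf x_1,\dots,\mathbf x_m)$ is the conditional distribution of $\mathbf x_n$ given the first $m$ samples. *Algorithm.* Given $\theta_1\in\Theta$, $v_0>0$ and $\alpha>0$, for $t=1,2,\dots$ let $$v_t=v_{t-1}+\|G(\theta_t,\mathbf x_{t+1})\|^2,\qquad \alpha_t=\frac{\alpha}{\sqrt{v_t}},\qquad \theta_{t+1}=\mathrm{proj}_\Theta\big(\theta_t-\alpha_tG(\theta_t,\mathbf x_{t+1})\big).$$ For $T\ge1$ let $\theta_T^{\mathrm{out}}$ be either $\theta_\tau$, with $\tau$ uniform on $\{1,\dots,T\}$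 and independent of the samples, or a point of $\{\theta_1,\dots,\theta_T\}$ minimizing $\|\nabla\varphi_{1/\hat\rho}\|^2$. *Conclusion.* The function $\varphi_{1/\hat\rho}$ is differentiable, and the following hold. (i) For every nondecreasing integer sequence $(k_t)_{t\ge1}$ with $1\le k_t\le t$ and every $T\ge1$, $\mathbb E\|\nabla\varphi_{1/\hat\rho}(\theta_T^{\mathrm{out}})\|^2$ is finite and at most $$B_T:=\frac{\hat\rho^2L}{T(\hat\rho-\rho)}\Bigg(\frac{2C_\varphi\sqrt{v_0+TL^2}}{\alpha\hat\rho L}+\sqrt T+\frac{2(L_1+\hat\rho)}{\hat\rho-\rho}\Big(\sqrt T\,k_T+\frac{\sqrt T\,k_T\alpha^2}{2}\log(1+v_0^{-1}TL^2)\Big)+\frac{2L}{\hat\rho-\rho}\sum_{t=1}^T\Delta_{[t-k_t,t+1]}\Bigg).$$ (ii) There are constants $K$ and $T_0$, depending only on $\rho,\hat\rho,L,L_1,C_\varphi,\alpha,v_0$, such that for all such $(k_t)$ and all $T\ge T_0$ $$B_T\le K\Big(\frac{k_T\log(TL^2)}{\sqrt T}+\frac1T\sum_{t=1}^T\Delta_{[t-k_t,t+1]}\Big).$$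 (iii) (Complexity $\tilde O(\varepsilon^{-4})$ under exponential mixing.) If $\Delta_{[t-k,t+1]}\le M r^k$ for all $1\le k\le t$, with $M>0$ and $r\in(0,1)$, then there is a constant $N>0$, depending only on $\rho,\hat\rho,L,L_1,C_\varphi,\alpha,v_0,M,r$, such that for all $\varepsilon\in(0,1]$ and all integers $T\ge N\varepsilon^{-4}(1+\log(1/\varepsilon))^4$ $$\mathbb E\|\nabla\varphi_{1/\hat\rho}(\theta_T^{\mathrm{out}})\|^2\le\varepsilon^2\qquad\text{and}\qquad \mathbb E\|\nabla\varphi_{1/\hat\rho}(\theta_T^{\mathrm{out}})\|\le\varepsilon .$$ -/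

import Mathlib

open MeasureTheory ProbabilityTheory Filter Topology

/-! ### Optimization notions -/

/-- The Fréchet subdifferential at `θ₀ ∈ Θ` of a function with domain `Θ`: all `w` with
`f θ - f θ₀ ≥ ⟪w, θ - θ₀⟫ + o(‖θ - θ₀‖)` as `θ → θ₀` in `Θ`. -/
def subdifferential {p : ℕ} (Θ : Set (EuclideanSpace ℝ (Fin p)))
    (f : EuclideanSpace ℝ (Fin p) → ℝ) (θ₀ : EuclideanSpace ℝ (Fin p)) :
    Set (EuclideanSpace ℝ (Fin p)) :=
  {w | ∀ ε : ℝ, 0 < ε → ∀ᶠ θ in 𝓝[Θ] θ₀,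
    f θ - f θ₀ ≥ inner ℝ w (θ - θ₀) - ε * ‖θ - θ₀‖}

/-- `f` is `ρ`-weakly convex on `Θ`. -/
def WeaklyConvexOn {p : ℕ} (ρ : ℝ) (Θ : Set (EuclideanSpace ℝ (Fin p)))
    (f : EuclideanSpace ℝ (Fin p) → ℝ) : Prop :=
  ConvexOn ℝ Θ (fun θ => f θ + ρ / 2 * ‖θ‖ ^ 2)

/-- The Moreau envelope with parameter `c` of `φ = f + ι_Θ`. Since `φ = +∞` off `Θ`, the infimum
of `φ θ' + ‖θ' - θ‖² / (2 c)` over the whole space is the infimum over `θ' ∈ Θ`. -/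
noncomputable def moreauEnvelope {p : ℕ} (Θ : Set (EuclideanSpace ℝ (Fin p)))
    (f : EuclideanSpace ℝ (Fin p) → ℝ) (c : ℝ) (θ : EuclideanSpace ℝ (Fin p)) : ℝ :=
  ⨅ θ' : Θ, (f θ' + 1 / (2 * c) * ‖(θ' : EuclideanSpace ℝ (Fin p)) - θ‖ ^ 2)

/-- `y` is the Euclidean projection of `z` onto `Θ`, i.e. a point of `Θ` nearest to `z`. -/
def IsProjection {p : ℕ} (Θ : Set (EuclideanSpace ℝ (Fin p)))
    (z y : EuclideanSpace ℝ (Fin p)) : Prop :=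
  y ∈ Θ ∧ ∀ w ∈ Θ, ‖z - y‖ ≤ ‖z - w‖

/-- The standing assumptions on the constraint set `Θ`, the objective `f`, the stochastic
subgradient oracle `G` and the target distribution `π`. -/
structure ProblemAssumptions {p : ℕ} {X : Type*} [MeasurableSpace X]
    (ρ L L₁ Cφ : ℝ) (Θ : Set (EuclideanSpace ℝ (Fin p)))
    (f : EuclideanSpace ℝ (Fin p) → ℝ)
    (G : EuclideanSpace ℝ (Fin p) → X → EuclideanSpace ℝ (Fin p)) (π : Measure X) : Prop where
  isClosed : IsClosed Θ
  convex : Convex ℝ Θ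
  weaklyConvex : WeaklyConvexOn ρ Θ f
  measurable : ∀ θ ∈ Θ, Measurable (G θ)
  mean_mem_subdifferential : ∀ θ ∈ Θ, (∫ ξ, G θ ξ ∂π) ∈ subdifferential Θ f θ
  lipschitz : ∀ ξ, ∀ θ ∈ Θ, ∀ θ' ∈ Θ, ‖G θ ξ - G θ' ξ‖ ≤ L₁ * ‖θ - θ'‖
  norm_le : ∀ θ ∈ Θ, ∀ ξ, ‖G θ ξ‖ ≤ L
  abs_le : ∀ θ ∈ Θ, |f θ| ≤ Cφ

/-! ### Dependent sampling -/

section Sampling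

variable {X : Type*} [MeasurableSpace X]

/-- Appending the next sample to a history. -/
def appendSample {m : ℕ} (q : (Fin m → X) × X) : Fin (m + 1) → X :=
  Fin.snoc (α := fun _ => X) q.1 q.2

theorem measurable_appendSample {m : ℕ} :
    Measurable (appendSample : (Fin m → X) × X → Fin (m + 1) → X) := by
  refine measurable_pi_lambda _ fun i => ?_
  refine Fin.lastCases ?_ (fun j => ?_) i
  · simpa [appendSample] using measurable_snd
  · have h : Measurable fun c : (Fin m → X) × X => c.1 j :=
      (measurable_pi_apply j).comp measurable_fst
    simpa [appendSample] using h

/-- A sampling scheme is given by kernels `κ n = π_{n+1}(· | x₁, …, x_n)`. Then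
`futureKernel κ j m` is the conditional distribution `π_{m+1+j}(· | x₁, …, x_m)` of the sample
`x_{m+1+j}` given the first `m` samples. -/
noncomputable def futureKernel (κ : ∀ n : ℕ, Kernel (Fin n → X) X) :
    (j m : ℕ) → Kernel (Fin m → X) X
  | 0, m => κ m
  | j + 1, m => futureKernel κ j (m + 1) ∘ₖ (Kernel.id ×ₖ κ m).map appendSample

instance isMarkovKernel_futureKernel (κ : ∀ n : ℕ, Kernel (Fin n → X) X)
    [∀ n, IsMarkovKernel (κ n)] (j m : ℕ) : IsMarkovKernel (futureKernel κ j m) := by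
  induction j generalizing m with
  | zero => rw [futureKernel]; infer_instance
  | succ j ih =>
    rw [futureKernel]
    have := ih (m + 1)
    have := Kernel.IsMarkovKernel.map (Kernel.id ×ₖ κ m) (measurable_appendSample (X := X) (m := m))
    infer_instance

/-- The recursion averages over the next sample: `π_{m+2+j}(A | h)` is the integral of
`π_{m+2+j}(A | h, ξ)` against `π_{m+1}(dξ | h)`. -/
theorem futureKernel_succ_apply (κ : ∀ n : ℕ, Kernel (Fin n → X) X)
    [∀ n, IsMarkovKernel (κ n)] (j m : ℕ) (h : Fin m → X) {A : Set X} (hA : MeasurableSet A) :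
    futureKernel κ (j + 1) m h A =
      ∫⁻ ξ, futureKernel κ j (m + 1) (appendSample (h, ξ)) A ∂κ m h := by
  have h1 : Measurable fun q : Fin (m + 1) → X => futureKernel κ j (m + 1) q A :=
    Kernel.measurable_coe _ hA
  have h2 : Measurable fun q : (Fin m → X) × X =>
      futureKernel κ j (m + 1) (appendSample q) A := h1.comp measurable_appendSample
  rw [futureKernel, Kernel.comp_apply' _ _ _ hA, Kernel.map_apply _ measurable_appendSample,
    lintegral_map h1 measurable_appendSample, Kernel.prod_apply, Kernel.id_apply]
  refine (lintegral_prod _ h2.aemeasurable).trans ?_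
  exact lintegral_dirac' _ h2.lintegral_prod_right'

/-- Total variation distance, `sup_A |μ A - ν A|`. -/
noncomputable def tvDist (μ ν : Measure X) : ℝ :=
  ⨆ A : {A : Set X // MeasurableSet A}, |μ.real A - ν.real A|

/-- `mixingCoeff κ π m n` is, for `m < n`, the worst-case total variation distance `Δ_{[m,n]}`
between the conditional distribution of `x_n` given `x₁, …, x_m` and `π`. -/
noncomputable def mixingCoeff (κ : ∀ n : ℕ, Kernel (Fin n → X) X) (π : Measure X) (m n : ℕ) : ℝ :=
  ⨆ h : Fin m → X, tvDist (futureKernel κ (n - m - 1) m h) π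

/-- The process `x₁, x₂, …` is sampled according to the kernels `κ`: for every `n ≥ 0` the
conditional distribution of `x_{n+1}` given `(x₁, …, x_n)` is `κ n`. (`x 0` is not used.) -/
structure IsSampledFrom {Ω : Type*} [MeasurableSpace Ω] (κ : ∀ n : ℕ, Kernel (Fin n → X) X)
    (P : Measure Ω) (x : ℕ → Ω → X) : Prop where
  measurable : ∀ n, 1 ≤ n → Measurable (x n)
  hasCondDistrib : ∀ n : ℕ,
    HasCondDistrib (x (n + 1)) (fun ω (i : Fin n) => x (i + 1) ω) (κ n) P

end Sampling

/-! ### Projected AdaGrad-norm -/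

/-- `θ₁, θ₂, …` (and the accumulators `v₀, v₁, …`) are generated by projected AdaGrad-norm:
`θ₁ ∈ Θ` is deterministic and, for `t ≥ 1`, `v_t = v_{t-1} + ‖G(θ_t, x_{t+1})‖²` and
`θ_{t+1} = proj_Θ (θ_t - α / √v_t • G(θ_t, x_{t+1}))`. (`θ 0` is not used.) -/
structure IsAdaGrad {p : ℕ} {X Ω : Type*} (Θ : Set (EuclideanSpace ℝ (Fin p)))
    (G : EuclideanSpace ℝ (Fin p) → X → EuclideanSpace ℝ (Fin p)) (α v₀ : ℝ)
    (x : ℕ → Ω → X) (θ : ℕ → Ω → EuclideanSpace ℝ (Fin p)) (v : ℕ → Ω → ℝ) : Prop where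
  init : ∃ θ₁ ∈ Θ, ∀ ω, θ 1 ω = θ₁
  init_acc : ∀ ω, v 0 ω = v₀
  acc : ∀ t, 1 ≤ t → ∀ ω, v t ω = v (t - 1) ω + ‖G (θ t ω) (x (t + 1) ω)‖ ^ 2
  step : ∀ t, 1 ≤ t → ∀ ω,
    IsProjection Θ (θ t ω - (α / √(v t ω)) • G (θ t ω) (x (t + 1) ω)) (θ (t + 1) ω)

/-- The output is `θ_τ`, where `τ` is uniform on `{1, …, T}` and independent of the samples. -/
def IsUniformOutput {p : ℕ} {X Ω : Type*} [MeasurableSpace X] [MeasurableSpace Ω]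
    (P : Measure Ω) (x : ℕ → Ω → X) (θ : ℕ → Ω → EuclideanSpace ℝ (Fin p)) (T : ℕ)
    (θout : Ω → EuclideanSpace ℝ (Fin p)) : Prop :=
  ∃ τ : Ω → ℕ, Measurable τ ∧ IndepFun τ (fun ω (n : ℕ) => x (n + 1) ω) P ∧
    (∀ t ∈ Finset.Icc 1 T, P.real {ω | τ ω = t} = 1 / T) ∧ ∀ ω, θout ω = θ (τ ω) ω

/-- The output is one of `θ₁, …, θ_T` with the smallest value of `‖∇ F‖²`. -/
def IsBestOutput {p : ℕ} {Ω : Type*} (F : EuclideanSpace ℝ (Fin p) → ℝ)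
    (θ : ℕ → Ω → EuclideanSpace ℝ (Fin p)) (T : ℕ)
    (θout : Ω → EuclideanSpace ℝ (Fin p)) : Prop :=
  ∀ ω, ∃ t ∈ Finset.Icc 1 T, θout ω = θ t ω ∧
    ∀ s ∈ Finset.Icc 1 T, ‖gradient F (θ t ω)‖ ^ 2 ≤ ‖gradient F (θ s ω)‖ ^ 2

/-- The right-hand side of the rate, where `k` stands for `k_T` and `S` for
`∑_{t=1}^T Δ_{[t-k_t, t+1]}`. -/
noncomputable def adagradBound (ρ ρhat L L₁ Cφ α v₀ T k S : ℝ) : ℝ :=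
  ρhat ^ 2 * L / (T * (ρhat - ρ)) *
    (2 * Cφ * √(v₀ + T * L ^ 2) / (α * ρhat * L) + √T
      + 2 * (L₁ + ρhat) / (ρhat - ρ) *
          (√T * k + √T * k * α ^ 2 / 2 * Real.log (1 + v₀⁻¹ * T * L ^ 2))
      + 2 * L / (ρhat - ρ) * S)

/-!
Let `e` be the Moreau envelope of `f + ι_Θ` with parameter `1 / r`, `r > ρ`, and `prox z` the
minimizer over `Θ` of `f + r / 2 * ‖· - z‖ ^ 2`. Weak convexity makes this function
`(r - ρ)`-strongly convex, which yields at once (`IsProxPoint.add_le`) that the residual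
`z ↦ z - prox z` is Lipschitz with constant `r / (r - ρ)`, that its norm is at most `L / (r - ρ)` on
`Θ`, and that `⟪w, z - prox z⟫ ≥ (r - ρ) ‖z - prox z‖ ^ 2` for every subgradient `w` at `z ∈ Θ`.
The envelope lies between two quadratics, so it is differentiable with gradient `r • (z - prox z)`
(`hasGradientAt_moreauEnvelope`). Hence it suffices to bound the sum over `t ≤ T` of
`E ⟪Ḡ(θ_t), θ_t - prox θ_t⟫`, where `Ḡ(θ)` is the mean of `G(θ, ·)` under `π`.

*Descent.* Comparing `e(θ_{t+1})` with the value at `prox θ_t` gives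
`r ⟪θ_t - prox θ_t, G(θ_t, x_{t+1})⟫ ≤ (e(θ_t) - e(θ_{t+1})) / α_t + r / 2 * α_t ‖G‖ ^ 2`.
The step size depends on the sample `x_{t+1}`, so the inequality is divided by `α_t` and summed
pathwise: `1 / α_t` is nondecreasing and `e` is bounded, so summation by parts applies
(`IsAdaGrad.sum_inner_le`). The second-order terms and the length of the path are controlled by
`∑ α_t ‖G‖ ≤ √T α √(log (1 + T L² / v₀))` (`IsAdaGrad.sum_stepLength_le`).

*Bias.* The difference between `⟪θ - prox θ, Ḡ(θ)⟫` and `⟪θ - prox θ, G(θ, x_{t+1})⟫` is Lipschitz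
in `θ`, so `θ_t` may be replaced by `θ_{t - k_t}` at a cost proportional to the path length over a
window of length `k_t`. The iterate `θ_{t - k_t}` is a measurable function of the first `t - k_t`
samples, and conditionally on them the law of `x_{t+1}` is within `Δ_{[t - k_t, t + 1]}` of `π` in
total variation (`IsSampledFrom.abs_integral_sub_le`, `IsAdaGrad.integral_bias_le`).

Together these give the explicit bound for the average over `t ≤ T` of the expected squared gradient
(`IsAdaGrad.average_le`), and both output rules are bounded by that average. The order of the bound
is elementary (`adagradBound_le`); under exponential mixing, lags `k_t = min t K` with `K` of order
`log T` give `O((1 + log T)² / √T)` (`exists_lag_adagradBound_le`), which is at most `ε²` as soon as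
`T ≥ N ε⁻⁴ (1 + log (1 / ε))⁴` (`one_add_log_sq_div_sqrt_le`).
-/

/-! ### Weak convexity and weak subgradients -/

theorem le_of_eventually_le_add_mul {a b c : ℝ} (h : ∀ᶠ l in 𝓝[>] (0 : ℝ), a ≤ b + l * c) :
    a ≤ b := by
  have h1 : Tendsto (fun l : ℝ => b + l * c) (𝓝[>] 0) (𝓝 (b + 0 * c)) :=
    ((continuous_const.add (continuous_id.mul continuous_const)).tendsto 0).mono_left
      nhdsWithin_le_nhds
  rw [zero_mul, add_zero] at h1
  exact ge_of_tendsto h1 h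

theorem norm_sq_segment {E : Type*} [NormedAddCommGroup E] [InnerProductSpace ℝ E]
    (u v : E) (l : ℝ) :
    ‖(1 - l) • u + l • v‖ ^ 2 =
      (1 - l) * ‖u‖ ^ 2 + l * ‖v‖ ^ 2 - l * (1 - l) * ‖v - u‖ ^ 2 := by
  rw [norm_add_sq_real, norm_sub_sq_real, norm_smul, norm_smul, mul_pow, mul_pow,
    real_inner_smul_left, real_inner_smul_right, Real.norm_eq_abs, Real.norm_eq_abs, sq_abs,
    sq_abs, real_inner_comm]
  ring

section WeakConvexity

variable {p : ℕ} {Θ : Set (EuclideanSpace ℝ (Fin p))} {f : EuclideanSpace ℝ (Fin p) → ℝ}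
  {ρ r L C : ℝ}

theorem WeaklyConvexOn.segment_le (hf : WeaklyConvexOn ρ Θ f) {a b : EuclideanSpace ℝ (Fin p)}
    (ha : a ∈ Θ) (hb : b ∈ Θ) {l : ℝ} (h0 : 0 ≤ l) (h1 : l ≤ 1) :
    f ((1 - l) • a + l • b) ≤
      (1 - l) * f a + l * f b + ρ / 2 * (l * (1 - l) * ‖b - a‖ ^ 2) := by
  have h := hf.2 ha hb (sub_nonneg.2 h1) h0 (by ring)
  simp only [smul_eq_mul] at h
  rw [norm_sq_segment] at h
  linarith

/-- For a weakly convex function the local subgradient inequality is global, with a quadratic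
error term. -/
theorem WeaklyConvexOn.le_of_mem_subdifferential (hf : WeaklyConvexOn ρ Θ f)
    {a b w : EuclideanSpace ℝ (Fin p)} (ha : a ∈ Θ) (hb : b ∈ Θ)
    (hw : w ∈ subdifferential Θ f a) :
    f a + inner ℝ w (b - a) - ρ / 2 * ‖b - a‖ ^ 2 ≤ f b := by
  have key : ∀ ε : ℝ, 0 < ε →
      f a + inner ℝ w (b - a) - ρ / 2 * ‖b - a‖ ^ 2 - ε * ‖b - a‖ ≤ f b := by
    intro ε hε
    have hseg : ∀ l : ℝ, (1 - l) • a + l • b = a + l • (b - a) := fun l => by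
      rw [sub_smul, one_smul, smul_sub]; abel
    have ht : Tendsto (fun l : ℝ => (1 - l) • a + l • b) (𝓝[>] 0) (𝓝[Θ] a) := by
      refine tendsto_nhdsWithin_iff.2 ⟨?_, ?_⟩
      · have hc : Continuous fun l : ℝ => (1 - l) • a + l • b := by fun_prop
        have := hc.tendsto 0
        simp only [sub_zero, one_smul, zero_smul, add_zero] at this
        exact this.mono_left nhdsWithin_le_nhds
      · filter_upwards [Ioo_mem_nhdsGT (zero_lt_one' ℝ)] with l hl
        exact hf.1 ha hb (by linarith [hl.2]) hl.1.le (by ring)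
    refine le_of_eventually_le_add_mul (c := -(ρ / 2 * ‖b - a‖ ^ 2)) ?_
    filter_upwards [ht.eventually (hw ε hε), Ioo_mem_nhdsGT (zero_lt_one' ℝ)] with l hl hl'
    have h2 := hf.segment_le ha hb hl'.1.le hl'.2.le
    have h3 : (1 - l) • a + l • b - a = l • (b - a) := by rw [hseg]; abel
    rw [h3, real_inner_smul_right, norm_smul, Real.norm_eq_abs, abs_of_pos hl'.1] at hl
    -- the subgradient inequality along the segment, to be divided by `l`
    have h4 : 0 ≤ l * (f b - (l * (-(ρ / 2 * ‖b - a‖ ^ 2)) * (-1) +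
        (f a + inner ℝ w (b - a) - ρ / 2 * ‖b - a‖ ^ 2 - ε * ‖b - a‖))) := by nlinarith
    have h5 := nonneg_of_mul_nonneg_right h4 hl'.1
    linarith
  rcases (norm_nonneg (b - a)).eq_or_lt with h0 | h0
  · have := key 1 one_pos
    rw [← h0] at this ⊢
    linarith
  · refine le_of_forall_pos_le_add fun ε hε => ?_
    have := key (ε / ‖b - a‖) (by positivity)
    rw [div_mul_cancel₀ _ h0.ne'] at this
    linarith

/-- A weakly convex function with bounded subgradients is continuous on its domain. -/
theorem WeaklyConvexOn.continuousOn (hf : WeaklyConvexOn ρ Θ f)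
    (hs : ∀ a ∈ Θ, ∃ w ∈ subdifferential Θ f a, ‖w‖ ≤ L) : ContinuousOn f Θ := by
  -- the subgradient inequality bounds `f` from below near `a` and, with the roles of `a` and `b`
  -- exchanged, from above
  have key : ∀ a ∈ Θ, ∀ b ∈ Θ, f a - f b ≤ L * ‖b - a‖ + ρ / 2 * ‖b - a‖ ^ 2 := by
    intro a ha b hb
    obtain ⟨w, hw, hwL⟩ := hs a ha
    have h1 := hf.le_of_mem_subdifferential ha hb hw
    have h2 := abs_le.1 (abs_real_inner_le_norm w (b - a))
    have h3 := mul_le_mul_of_nonneg_right hwL (norm_nonneg (b - a))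
    linarith [h2.1]
  intro a ha
  refine tendsto_iff_norm_sub_tendsto_zero.2 ?_
  have hc : Continuous fun b : EuclideanSpace ℝ (Fin p) =>
      L * ‖b - a‖ + ρ / 2 * ‖b - a‖ ^ 2 := by fun_prop
  have hlim := hc.tendsto a
  simp only [sub_self, norm_zero, mul_zero, ne_eq, OfNat.ofNat_ne_zero, not_false_eq_true,
    zero_pow, add_zero] at hlim
  refine squeeze_zero' (Eventually.of_forall fun _ => norm_nonneg _) ?_
    (hlim.mono_left nhdsWithin_le_nhds)
  filter_upwards [self_mem_nhdsWithin] with b hb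
  rw [Real.norm_eq_abs, abs_le]
  have h1 := key a ha b hb
  have h2 := key b hb a ha
  rw [norm_sub_rev] at h2
  constructor <;> linarith

/-! ### Proximal points -/

/-- `y` is a proximal point of `z` with parameter `1 / r` for `f + ι_Θ`, i.e. a minimizer over `Θ`
of `f + r / 2 * ‖· - z‖ ^ 2`. -/
def IsProxPoint (Θ : Set (EuclideanSpace ℝ (Fin p))) (f : EuclideanSpace ℝ (Fin p) → ℝ) (r : ℝ)
    (z y : EuclideanSpace ℝ (Fin p)) : Prop :=
  y ∈ Θ ∧ ∀ w ∈ Θ, f y + r / 2 * ‖y - z‖ ^ 2 ≤ f w + r / 2 * ‖w - z‖ ^ 2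

theorem exists_isProxPoint (hΘ : IsClosed Θ) (hne : Θ.Nonempty) (hf : ContinuousOn f Θ)
    (hb : ∀ a ∈ Θ, |f a| ≤ C) (hr : 0 < r) (z : EuclideanSpace ℝ (Fin p)) :
    ∃ y, IsProxPoint Θ f r z y := by
  obtain ⟨a, ha⟩ := hne
  have hcont : ContinuousOn (fun w => f w + r / 2 * ‖w - z‖ ^ 2) Θ := by fun_prop
  obtain ⟨y, hy, hmin⟩ := hcont.exists_isMinOn' hΘ ha (by
    have h1 : Tendsto (fun w : EuclideanSpace ℝ (Fin p) => r / 2 * dist w z ^ 2)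
        (cocompact _) atTop :=
      Tendsto.const_mul_atTop (half_pos hr)
        ((tendsto_pow_atTop two_ne_zero).comp (tendsto_dist_right_cocompact_atTop z))
    have h2 := (h1.eventually_ge_atTop (C + (f a + r / 2 * ‖a - z‖ ^ 2))).filter_mono
      (inf_le_left : cocompact _ ⊓ 𝓟 Θ ≤ cocompact _)
    filter_upwards [h2, mem_inf_of_right (mem_principal_self Θ)] with w hw hwΘ
    rw [dist_eq_norm] at hw
    have := (abs_le.1 (hb w hwΘ)).1
    linarith)
  exact ⟨y, hy, fun w hw => hmin hw⟩

/-- Since `f + r / 2 * ‖· - z‖ ^ 2` is `(r - ρ)`-strongly convex, it grows quadratically away from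
its minimizer. -/
theorem IsProxPoint.add_le (hf : WeaklyConvexOn ρ Θ f) {z y w : EuclideanSpace ℝ (Fin p)}
    (hy : IsProxPoint Θ f r z y) (hw : w ∈ Θ) :
    f y + r / 2 * ‖y - z‖ ^ 2 + (r - ρ) / 2 * ‖w - y‖ ^ 2 ≤ f w + r / 2 * ‖w - z‖ ^ 2 := by
  refine le_of_eventually_le_add_mul (c := (r - ρ) / 2 * ‖w - y‖ ^ 2) ?_
  filter_upwards [Ioo_mem_nhdsGT (zero_lt_one' ℝ)] with l hl
  have h1 := hy.2 _ (hf.1 hy.1 hw (sub_nonneg.2 hl.2.le) hl.1.le (by ring))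
  have h2 := hf.segment_le hy.1 hw hl.1.le hl.2.le
  have h3 : (1 - l) • y + l • w - z = (1 - l) • (y - z) + l • (w - z) := by
    simp only [smul_sub, sub_smul, one_smul]; abel
  rw [h3, norm_sq_segment, sub_sub_sub_cancel_right] at h1
  -- minimality of `y` against the point `(1 - l) • y + l • w`, to be divided by `l`
  have h4 : 0 ≤ l * (f w + r / 2 * ‖w - z‖ ^ 2 + l * ((r - ρ) / 2 * ‖w - y‖ ^ 2)
      - (f y + r / 2 * ‖y - z‖ ^ 2 + (r - ρ) / 2 * ‖w - y‖ ^ 2)) := by nlinarith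
  have h5 := nonneg_of_mul_nonneg_right h4 hl.1
  linarith

/-- Adding the growth inequalities at two proximal points: `prox` is monotone, even cocoercive. -/
theorem IsProxPoint.inner_le (hf : WeaklyConvexOn ρ Θ f) {z z' y y' : EuclideanSpace ℝ (Fin p)}
    (hy : IsProxPoint Θ f r z y) (hy' : IsProxPoint Θ f r z' y') :
    (r - ρ) * ‖y - y'‖ ^ 2 ≤ r * inner ℝ (z - z') (y - y') := by
  have h1 := hy.add_le hf hy'.1
  have h2 := hy'.add_le hf hy.1
  rw [norm_sub_rev y' y] at h1
  have e : inner ℝ (z - z') (y - y') =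
      (‖y' - z‖ ^ 2 - ‖y - z‖ ^ 2 + ‖y - z'‖ ^ 2 - ‖y' - z'‖ ^ 2) / 2 := by
    simp only [norm_sub_sq_real, inner_sub_left, inner_sub_right,
      real_inner_comm z, real_inner_comm z']
    ring
  rw [e]
  linarith

/-- The residual `z - prox z` is Lipschitz with constant `r / (r - ρ)`. -/
theorem IsProxPoint.norm_residual_sub_le (hf : WeaklyConvexOn ρ Θ f) (hρ : 0 ≤ ρ) (hr : ρ < r)
    {z z' y y' : EuclideanSpace ℝ (Fin p)}
    (hy : IsProxPoint Θ f r z y) (hy' : IsProxPoint Θ f r z' y') :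
    ‖(z - y) - (z' - y')‖ ≤ r / (r - ρ) * ‖z - z'‖ := by
  have hd : 0 < r - ρ := sub_pos.2 hr
  have h := hy.inner_le hf hy'
  set D := z - z'
  set F := y - y'
  have e : (z - y) - (z' - y') = D - F := by simp only [D, F]; abel
  set k := r / (r - ρ)
  have hk : 1 ≤ k := by rw [one_le_div hd]; linarith
  have h' : ‖F‖ ^ 2 ≤ k * inner ℝ D F := by
    have : k * inner ℝ D F = (r * inner ℝ D F) / (r - ρ) := by simp only [k]; ring
    rw [this, le_div_iff₀ hd]
    linarith
  have hi := real_inner_le_norm D F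
  have hi0 : 0 ≤ inner ℝ D F := by
    have : 0 ≤ k * inner ℝ D F := (sq_nonneg _).trans h'
    exact nonneg_of_mul_nonneg_right this (by linarith)
  have hF : ‖F‖ ≤ k * ‖D‖ := by
    by_contra hcon
    push Not at hcon
    have hF0 : 0 < ‖F‖ := lt_of_le_of_lt (by positivity) hcon
    have : k * inner ℝ D F ≤ (k * ‖D‖) * ‖F‖ := by
      rw [mul_assoc]; exact mul_le_mul_of_nonneg_left hi (by linarith)
    nlinarith
  have hi2 : inner ℝ D F ≤ k * ‖D‖ ^ 2 := by nlinarith [norm_nonneg D]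
  rw [e]
  refine le_of_sq_le_sq ?_ (by positivity)
  rw [norm_sub_sq_real, mul_pow]
  -- `‖D - F‖² ≤ ‖D‖² + (k - 2) ⟪D, F⟫`, and the sign of `k - 2` decides which bound on the inner
  -- product applies
  rcases le_total k 2 with h2 | h2
  · have : (2 - k) * inner ℝ D F ≥ 0 := mul_nonneg (by linarith) hi0
    nlinarith [sq_nonneg ‖D‖, mul_nonneg (sub_nonneg.2 hk) (sq_nonneg ‖D‖)]
  · have : (k - 2) * inner ℝ D F ≤ (k - 2) * (k * ‖D‖ ^ 2) :=
      mul_le_mul_of_nonneg_left hi2 (by linarith)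
    nlinarith [sq_nonneg ‖D‖, mul_nonneg (sub_nonneg.2 hk) (sq_nonneg ‖D‖)]

/-- A subgradient at `z ∈ Θ` is positively correlated with the residual `z - prox z`. -/
theorem IsProxPoint.mul_norm_sq_le_inner (hf : WeaklyConvexOn ρ Θ f)
    {z y w : EuclideanSpace ℝ (Fin p)} (hy : IsProxPoint Θ f r z y) (hz : z ∈ Θ)
    (hw : w ∈ subdifferential Θ f z) : (r - ρ) * ‖z - y‖ ^ 2 ≤ inner ℝ w (z - y) := by
  have h1 := hy.add_le hf hz
  have h2 := hf.le_of_mem_subdifferential hz hy.1 hw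
  rw [sub_self, norm_zero] at h1
  rw [norm_sub_rev y z] at h1 h2
  have h3 : inner ℝ w (y - z) = -inner ℝ w (z - y) := by rw [← inner_neg_right, neg_sub]
  rw [h3] at h2
  linarith

theorem IsProxPoint.norm_residual_le (hf : WeaklyConvexOn ρ Θ f) (hr : ρ < r)
    {z y w : EuclideanSpace ℝ (Fin p)} (hy : IsProxPoint Θ f r z y) (hz : z ∈ Θ)
    (hw : w ∈ subdifferential Θ f z) (hwL : ‖w‖ ≤ L) : ‖z - y‖ ≤ L / (r - ρ) := by
  have hd : 0 < r - ρ := sub_pos.2 hr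
  have h1 := hy.mul_norm_sq_le_inner hf hz hw
  have h2 := real_inner_le_norm w (z - y)
  have h3 := mul_le_mul_of_nonneg_right hwL (norm_nonneg (z - y))
  rw [le_div_iff₀ hd]
  rcases (norm_nonneg (z - y)).eq_or_lt with h0 | h0
  · rw [← h0, zero_mul]; exact (norm_nonneg w).trans hwL
  · exact le_of_mul_le_mul_right (by nlinarith) h0

/-- A projection is a proximal point of the zero function, which is weakly convex with constant `0`;
nonexpansiveness of projections is thus a case of cocoercivity of `prox`. -/
theorem IsProjection.isProxPoint {z y : EuclideanSpace ℝ (Fin p)} (h : IsProjection Θ z y) :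
    IsProxPoint Θ (fun _ => 0) 1 z y := by
  refine ⟨h.1, fun w hw => ?_⟩
  have := h.2 w hw
  rw [norm_sub_rev y, norm_sub_rev w]
  gcongr

theorem IsProjection.norm_sub_le (hΘ : Convex ℝ Θ) {z z' y y' : EuclideanSpace ℝ (Fin p)}
    (h : IsProjection Θ z y) (h' : IsProjection Θ z' y') : ‖y - y'‖ ≤ ‖z - z'‖ := by
  have h0 : WeaklyConvexOn 0 Θ fun _ => (0 : ℝ) := by
    simpa [WeaklyConvexOn] using convexOn_const (0 : ℝ) hΘ
  have h1 := h.isProxPoint.inner_le h0 h'.isProxPoint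
  have h2 := real_inner_le_norm (z - z') (y - y')
  rcases (norm_nonneg (y - y')).eq_or_lt with h3 | h3
  · rw [← h3]; exact norm_nonneg _
  · exact le_of_mul_le_mul_right (by nlinarith) h3

theorem isProjection_self {z : EuclideanSpace ℝ (Fin p)} (h : z ∈ Θ) : IsProjection Θ z z :=
  ⟨h, fun w _ => by simp⟩

/-! ### The Moreau envelope -/

theorem IsProxPoint.moreauEnvelope_eq {z y : EuclideanSpace ℝ (Fin p)}
    (hy : IsProxPoint Θ f r z y) :
    moreauEnvelope Θ f (1 / r) z = f y + r / 2 * ‖y - z‖ ^ 2 := by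
  have e : (1 : ℝ) / (2 * (1 / r)) = r / 2 := by
    rcases eq_or_ne r 0 with rfl | h
    · simp
    · field_simp
  have : Nonempty Θ := ⟨⟨y, hy.1⟩⟩
  rw [moreauEnvelope, e]
  refine le_antisymm (ciInf_le ⟨f y + r / 2 * ‖y - z‖ ^ 2, ?_⟩ (⟨y, hy.1⟩ : Θ))
    (le_ciInf fun w => hy.2 w w.2)
  rintro _ ⟨w, rfl⟩
  exact hy.2 w w.2

theorem IsProxPoint.moreauEnvelope_le {z y w : EuclideanSpace ℝ (Fin p)}
    (hy : IsProxPoint Θ f r z y) (hw : w ∈ Θ) :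
    moreauEnvelope Θ f (1 / r) z ≤ f w + r / 2 * ‖w - z‖ ^ 2 := by
  rw [hy.moreauEnvelope_eq]; exact hy.2 w hw

/-- The Moreau envelope is differentiable with gradient `r • (z - prox z)`: it lies below the
quadratic through the proximal point of `z`, and the symmetric bound at `z'` together with the
Lipschitz continuity of the residual gives a quadratic lower bound. -/
theorem hasGradientAt_moreauEnvelope (hf : WeaklyConvexOn ρ Θ f) (hρ : 0 ≤ ρ) (hr : ρ < r)
    {prox : EuclideanSpace ℝ (Fin p) → EuclideanSpace ℝ (Fin p)}
    (hp : ∀ z, IsProxPoint Θ f r z (prox z)) (z : EuclideanSpace ℝ (Fin p)) :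
    HasGradientAt (moreauEnvelope Θ f (1 / r)) (r • (z - prox z)) z := by
  have hr0 : 0 < r := hρ.trans_lt hr
  have up : ∀ a b, moreauEnvelope Θ f (1 / r) b ≤ moreauEnvelope Θ f (1 / r) a
      + r * inner ℝ (a - prox a) (b - a) + r / 2 * ‖b - a‖ ^ 2 := by
    intro a b
    have h1 := (hp b).moreauEnvelope_le (hp a).1
    rw [(hp a).moreauEnvelope_eq]
    have e : prox a - b = (prox a - a) - (b - a) := by abel
    rw [e, norm_sub_sq_real] at h1
    have e2 : inner ℝ (prox a - a) (b - a) = -inner ℝ (a - prox a) (b - a) := by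
      rw [← inner_neg_left, neg_sub]
    rw [e2] at h1
    linarith
  rw [hasGradientAt_iff_isLittleO]
  refine (Asymptotics.IsBigO.of_bound (r * (r / (r - ρ)) + r / 2) ?_).trans_isLittleO
    (g := fun b => ‖b - z‖ ^ 2) ?_
  · refine Eventually.of_forall fun b => ?_
    have h1 := up z b
    have h2 := up b z
    have h3 := (hp b).norm_residual_sub_le hf hρ hr (hp z)
    have h4 := (abs_le.1 (abs_real_inner_le_norm ((b - prox b) - (z - prox z)) (b - z))).1
    have h5 : -(r / (r - ρ) * ‖b - z‖ ^ 2) ≤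
        inner ℝ ((b - prox b) - (z - prox z)) (b - z) := by
      refine le_trans (neg_le_neg ?_) h4
      rw [pow_two, ← mul_assoc]
      exact mul_le_mul_of_nonneg_right h3 (norm_nonneg _)
    have e : inner ℝ (b - prox b) (z - b) = -inner ℝ (b - prox b) (b - z) := by
      rw [← inner_neg_right, neg_sub]
    rw [e, norm_sub_rev z b] at h2
    rw [inner_sub_left] at h5
    have h6 := mul_le_mul_of_nonneg_left h5 hr0.le
    have h7 : 0 ≤ r * (r / (r - ρ)) * ‖b - z‖ ^ 2 :=
      mul_nonneg (mul_nonneg hr0.le (div_nonneg hr0.le (sub_pos.2 hr).le)) (sq_nonneg _)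
    rw [real_inner_smul_left, Real.norm_eq_abs, Real.norm_eq_abs, abs_of_nonneg (sq_nonneg ‖b - z‖),
      abs_le]
    constructor <;> nlinarith
  · refine Asymptotics.isLittleO_pow_sub_sub z one_lt_two |>.congr_left ?_
    intro b; rfl

end WeakConvexity

/-! ### Total variation and mixing coefficients -/

section TotalVariation

variable {X : Type*} [MeasurableSpace X]

theorem abs_measureReal_sub_le_one (μ ν : Measure X) [IsProbabilityMeasure μ]
    [IsProbabilityMeasure ν] (A : Set X) : |μ.real A - ν.real A| ≤ 1 := by
  have h1 := measureReal_le_one (μ := μ) (s := A)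
  have h2 := measureReal_le_one (μ := ν) (s := A)
  have h3 := measureReal_nonneg (μ := μ) (s := A)
  have h4 := measureReal_nonneg (μ := ν) (s := A)
  exact abs_le.2 ⟨by linarith, by linarith⟩

theorem bddAbove_tvDist (μ ν : Measure X) [IsProbabilityMeasure μ] [IsProbabilityMeasure ν] :
    BddAbove (Set.range fun A : {A : Set X // MeasurableSet A} => |μ.real A - ν.real A|) := by
  refine ⟨1, ?_⟩
  rintro _ ⟨A, rfl⟩
  exact abs_measureReal_sub_le_one μ ν A

theorem abs_measureReal_sub_le_tvDist (μ ν : Measure X) [IsProbabilityMeasure μ]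
    [IsProbabilityMeasure ν] {A : Set X} (hA : MeasurableSet A) :
    |μ.real A - ν.real A| ≤ tvDist μ ν :=
  le_ciSup (bddAbove_tvDist μ ν) ⟨A, hA⟩

theorem tvDist_nonneg (μ ν : Measure X) : 0 ≤ tvDist μ ν :=
  Real.iSup_nonneg fun _ => abs_nonneg _

theorem tvDist_le_one (μ ν : Measure X) [IsProbabilityMeasure μ] [IsProbabilityMeasure ν] :
    tvDist μ ν ≤ 1 := by
  have : Nonempty {A : Set X // MeasurableSet A} := ⟨⟨∅, MeasurableSet.empty⟩⟩
  exact ciSup_le fun A => abs_measureReal_sub_le_one μ ν A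

/-- Layer-cake: the integral of a function with values in `[-B, B]` is, up to a shift by `B`, an
integral over the levels in `(0, 2 * B]` of measures of superlevel sets. -/
theorem abs_integral_sub_integral_le_tvDist (μ ν : Measure X) [IsProbabilityMeasure μ]
    [IsProbabilityMeasure ν] {g : X → ℝ} (hg : Measurable g) {B : ℝ} (hB : ∀ ξ, |g ξ| ≤ B) :
    |∫ ξ, g ξ ∂μ - ∫ ξ, g ξ ∂ν| ≤ 2 * B * tvDist μ ν := by
  have hint : ∀ (η : Measure X) [IsProbabilityMeasure η], Integrable g η := fun η _ =>
    Integrable.of_bound hg.aestronglyMeasurable B (ae_of_all _ hB)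
  have hB0 : 0 ≤ B := by
    obtain ⟨ξ⟩ := nonempty_of_isProbabilityMeasure μ
    exact (abs_nonneg _).trans (hB ξ)
  have key : ∀ (η : Measure X) [IsProbabilityMeasure η],
      ∫ ξ, g ξ ∂η + B = ∫ t in Set.Ioc 0 (2 * B), η.real {ξ | t ≤ g ξ + B} := by
    intro η _
    have h1 : ∫ ξ, (g ξ + B) ∂η = ∫ ξ, g ξ ∂η + B := by
      rw [integral_add (hint η) (integrable_const B)]; simp
    rw [← h1]
    refine ((hint η).add (integrable_const B)).integral_eq_integral_Ioc_meas_le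
      (ae_of_all _ fun ξ => ?_) (ae_of_all _ fun ξ => ?_)
    · have := (abs_le.1 (hB ξ)).1
      change 0 ≤ g ξ + B
      linarith
    · have := (abs_le.1 (hB ξ)).2
      change g ξ + B ≤ 2 * B
      linarith
  have hmeas : ∀ (η : Measure X) [IsProbabilityMeasure η],
      IntegrableOn (fun t => η.real {ξ | t ≤ g ξ + B}) (Set.Ioc 0 (2 * B)) := by
    intro η _
    have hanti : Antitone fun t => η.real {ξ | t ≤ g ξ + B} := fun s t hst =>
      measureReal_mono fun ξ (hξ : t ≤ g ξ + B) => hst.trans hξ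
    exact (hanti.antitoneOn (Set.Icc 0 (2 * B))).integrableOn_isCompact isCompact_Icc
      |>.mono_set Set.Ioc_subset_Icc_self
  have e : ∫ ξ, g ξ ∂μ - ∫ ξ, g ξ ∂ν =
      ∫ t in Set.Ioc 0 (2 * B), (μ.real {ξ | t ≤ g ξ + B} - ν.real {ξ | t ≤ g ξ + B}) := by
    rw [integral_sub (hmeas μ) (hmeas ν), ← key μ, ← key ν]; ring
  rw [e, ← Real.norm_eq_abs]
  have h2 := norm_setIntegral_le_of_norm_le_const (μ := volume) (s := Set.Ioc 0 (2 * B))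
    (f := fun t => μ.real {ξ | t ≤ g ξ + B} - ν.real {ξ | t ≤ g ξ + B}) (C := tvDist μ ν)
    measure_Ioc_lt_top (fun t _ => by
      rw [Real.norm_eq_abs]
      exact abs_measureReal_sub_le_tvDist μ ν
        (measurableSet_le measurable_const (hg.add_const B)))
  rw [Real.volume_real_Ioc_of_le (by linarith), sub_zero] at h2
  linarith

theorem mixingCoeff_nonneg (κ : ∀ n : ℕ, Kernel (Fin n → X) X) (π : Measure X) (m n : ℕ) :
    0 ≤ mixingCoeff κ π m n :=
  Real.iSup_nonneg fun _ => tvDist_nonneg _ _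

theorem tvDist_futureKernel_le_mixingCoeff (κ : ∀ n : ℕ, Kernel (Fin n → X) X)
    [∀ n, IsMarkovKernel (κ n)] (π : Measure X) [IsProbabilityMeasure π] (j m : ℕ)
    (h : Fin m → X) : tvDist (futureKernel κ j m h) π ≤ mixingCoeff κ π m (m + 1 + j) := by
  have e : m + 1 + j - m - 1 = j := by omega
  rw [mixingCoeff, e]
  refine le_ciSup (f := fun h => tvDist (futureKernel κ j m h) π) ⟨1, ?_⟩ h
  rintro _ ⟨q, rfl⟩
  exact tvDist_le_one _ _

end TotalVariation

/-! ### Conditional laws of future samples -/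

/-- The history `(x₁, …, x_m)`. -/
def history {X Ω : Type*} (x : ℕ → Ω → X) (m : ℕ) (ω : Ω) : Fin m → X := fun i => x (i + 1) ω

theorem history_succ {X Ω : Type*} (x : ℕ → Ω → X) (m : ℕ) (ω : Ω) :
    history x (m + 1) ω = appendSample (history x m ω, x (m + 1) ω) := by
  funext i
  refine Fin.lastCases ?_ (fun j => ?_) i <;> simp [appendSample, history]

section Sampling

variable {X Ω : Type*} [MeasurableSpace X] [MeasurableSpace Ω] {P : Measure Ω}
  {κ : ∀ n : ℕ, Kernel (Fin n → X) X} {x : ℕ → Ω → X}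

theorem IsSampledFrom.measurable_history (hx : IsSampledFrom κ P x) (m : ℕ) :
    Measurable (history x m) :=
  measurable_pi_lambda _ fun i => hx.measurable _ (by omega)

variable [IsProbabilityMeasure P] [∀ n, IsMarkovKernel (κ n)]

/-- `futureKernel κ j m` is the conditional distribution of `x_{m+1+j}` given the first `m`
samples. -/
theorem IsSampledFrom.hasCondDistrib_future (hx : IsSampledFrom κ P x) (j m : ℕ) :
    HasCondDistrib (x (m + 1 + j)) (history x m) (futureKernel κ j m) P := by
  induction j generalizing m with
  | zero => exact hx.hasCondDistrib m
  | succ j ih =>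
    have hY : Measurable (x (m + 1 + (j + 1))) := hx.measurable _ (by omega)
    have hH := hx.measurable_history
    have hx1 : Measurable (x (m + 1)) := hx.measurable _ (by omega)
    have h1 := (ih (m + 1)).map_eq
    have h0 : P.map (fun ω => (history x m ω, x (m + 1) ω)) = P.map (history x m) ⊗ₘ κ m :=
      (hx.hasCondDistrib m).map_eq
    rw [show m + 1 + 1 + j = m + 1 + (j + 1) by omega] at h1
    refine ⟨((hH m).prodMk hY).aemeasurable, Measure.ext fun s hs => ?_⟩
    -- the law of the pair is the image of the one with one more sample in the history, under
    -- forgetting that sample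
    have hr : Measurable fun q : (Fin (m + 1) → X) × X =>
        ((fun i : Fin m => q.1 i.castSucc), q.2) := by
      refine Measurable.prodMk (measurable_pi_lambda _ fun i => ?_) measurable_snd
      exact (measurable_pi_apply _).comp measurable_fst
    have e1 : P.map (fun ω => (history x m ω, x (m + 1 + (j + 1)) ω)) =
        (P.map fun ω => (history x (m + 1) ω, x (m + 1 + (j + 1)) ω)).map
          fun q : (Fin (m + 1) → X) × X => ((fun i : Fin m => q.1 i.castSucc), q.2) := by
      rw [Measure.map_map hr ((hH _).prodMk hY)]
      rfl
    have e2 : P.map (history x (m + 1)) =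
        (P.map fun ω => (history x m ω, x (m + 1) ω)).map appendSample := by
      rw [Measure.map_map measurable_appendSample ((hH _).prodMk hx1)]
      congr 1
      funext ω
      exact history_succ x m ω
    have e3 : ∀ (h : Fin m → X) (ξ : X), (fun i : Fin m => appendSample (h, ξ) i.castSucc) = h :=
      fun h ξ => by funext i; simp [appendSample]
    rw [e1, h1, Measure.map_apply hr hs, Measure.compProd_apply (hr hs), e2,
      lintegral_map (Kernel.measurable_kernel_prodMk_left (hr hs)) measurable_appendSample, h0,
      Measure.lintegral_compProd (f := fun a => futureKernel κ j (m + 1) (appendSample a)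
        (Prod.mk (appendSample a) ⁻¹' ((fun q : (Fin (m + 1) → X) × X =>
          ((fun i : Fin m => q.1 i.castSucc), q.2)) ⁻¹' s)))
        ((Kernel.measurable_kernel_prodMk_left (hr hs)).comp measurable_appendSample),
      Measure.compProd_apply hs]
    refine lintegral_congr fun h => ?_
    rw [futureKernel_succ_apply _ _ _ _ (measurable_prodMk_left hs)]
    refine lintegral_congr fun ξ => ?_
    congr 1
    ext y
    simp only [Set.mem_preimage, e3]

/-- Replacing the sample `x_{m+1+j}` by an independent draw from `π` changes the expectation of a
bounded function of it and of the first `m` samples by at most the mixing coefficient. -/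
theorem IsSampledFrom.abs_integral_sub_le (hx : IsSampledFrom κ P x) {π : Measure X}
    [IsProbabilityMeasure π] (j m : ℕ) {ψ : (Fin m → X) × X → ℝ} (hψ : Measurable ψ) {B : ℝ}
    (hB : ∀ q, |ψ q| ≤ B) :
    |∫ ω, ψ (history x m ω, x (m + 1 + j) ω) ∂P - ∫ ω, ∫ ξ, ψ (history x m ω, ξ) ∂π ∂P| ≤
      2 * B * mixingCoeff κ π m (m + 1 + j) := by
  have hH := hx.measurable_history m
  have hY : Measurable (x (m + 1 + j)) := hx.measurable _ (by omega)
  have hprob : IsProbabilityMeasure (P.map (history x m)) :=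
    Measure.isProbabilityMeasure_map hH.aemeasurable
  have hlaw := (hx.hasCondDistrib_future j m).map_eq
  have e1 : ∫ ω, ψ (history x m ω, x (m + 1 + j) ω) ∂P =
      ∫ h, ∫ ξ, ψ (h, ξ) ∂futureKernel κ j m h ∂P.map (history x m) := by
    rw [← integral_map (φ := fun ω => (history x m ω, x (m + 1 + j) ω))
      (hH.prodMk hY).aemeasurable hψ.aestronglyMeasurable, hlaw]
    refine Measure.integral_compProd ?_
    exact Integrable.of_bound hψ.aestronglyMeasurable B (ae_of_all _ hB)
  have hm2 : Measurable fun h => ∫ ξ, ψ (h, ξ) ∂π :=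
    (hψ.stronglyMeasurable.integral_prod_right' (ν := π)).measurable
  have hm1 : Measurable fun h => ∫ ξ, ψ (h, ξ) ∂futureKernel κ j m h :=
    (hψ.stronglyMeasurable.integral_kernel_prod_right' (κ := futureKernel κ j m)).measurable
  have hb : ∀ (η : Measure X) [IsProbabilityMeasure η] h, ‖∫ ξ, ψ (h, ξ) ∂η‖ ≤ B := by
    intro η _ h
    simpa using norm_integral_le_of_norm_le_const (μ := η) (f := fun ξ => ψ (h, ξ))
      (ae_of_all _ fun ξ => hB (h, ξ))
  rw [e1, ← integral_map hH.aemeasurable hm2.aestronglyMeasurable,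
    ← integral_sub (Integrable.of_bound hm1.aestronglyMeasurable B (ae_of_all _ fun h => hb _ h))
      (Integrable.of_bound hm2.aestronglyMeasurable B (ae_of_all _ fun h => hb _ h)),
    ← Real.norm_eq_abs]
  refine (norm_integral_le_of_norm_le_const (C := 2 * B * mixingCoeff κ π m (m + 1 + j))
    (ae_of_all _ fun h => ?_)).trans (by simp)
  rw [Real.norm_eq_abs]
  refine (abs_integral_sub_integral_le_tvDist _ _ (hψ.comp measurable_prodMk_left)
    fun ξ => hB (h, ξ)).trans ?_
  have hB0 : 0 ≤ B := by
    obtain ⟨ω⟩ := nonempty_of_isProbabilityMeasure P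
    exact (abs_nonneg _).trans (hB (history x m ω, x (m + 1 + j) ω))
  have := tvDist_futureKernel_le_mixingCoeff κ π j m h
  gcongr

end Sampling

/-! ### Scalar summation lemmas -/

/-- Summation by parts for a bounded sequence against nondecreasing weights. -/
theorem sum_sub_mul_le_of_monotone {e b : ℕ → ℝ} {C : ℝ} (he : ∀ t, 1 ≤ t → |e t| ≤ C)
    (hb : ∀ t, 1 ≤ t → 0 ≤ b t) (hmono : ∀ t, 1 ≤ t → b t ≤ b (t + 1)) {T : ℕ} (hT : 1 ≤ T) :
    ∑ t ∈ Finset.Icc 1 T, (e t - e (t + 1)) * b t ≤ 2 * C * b T := by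
  have key : ∑ t ∈ Finset.Icc 1 T, (e t - e (t + 1)) * b t ≤ (C - e (T + 1)) * b T := by
    induction T, hT using Nat.le_induction with
    | base =>
      rw [Finset.Icc_self, Finset.sum_singleton]
      exact mul_le_mul_of_nonneg_right (by linarith [(abs_le.1 (he 1 le_rfl)).2]) (hb 1 le_rfl)
    | succ T hT ih =>
      rw [Finset.sum_Icc_succ_top (by omega)]
      have h1 : 0 ≤ C - e (T + 1) := by linarith [(abs_le.1 (he (T + 1) (by omega))).2]
      have h2 := mul_le_mul_of_nonneg_left (hmono T hT) h1
      linarith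
  refine key.trans (mul_le_mul_of_nonneg_right ?_ (hb T hT))
  linarith [(abs_le.1 (he (T + 1) (by omega))).1]

/-- The sum over time windows of length at most `K` counts each term at most `K` times. -/
theorem sum_window_le {d : ℕ → ℝ} (hd : ∀ s, 0 ≤ d s) {T K : ℕ} {a : ℕ → ℕ}
    (ha : ∀ t ∈ Finset.Icc 1 T, 1 ≤ a t ∧ t ≤ a t + K) :
    ∑ t ∈ Finset.Icc 1 T, ∑ s ∈ Finset.Ico (a t) t, d s ≤ K * ∑ s ∈ Finset.Icc 1 T, d s := by
  calc ∑ t ∈ Finset.Icc 1 T, ∑ s ∈ Finset.Ico (a t) t, d s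
      ≤ ∑ t ∈ Finset.Icc 1 T, ∑ s ∈ Finset.Icc 1 T,
          if t ∈ Finset.Ioc s (s + K) then d s else 0 := by
        refine Finset.sum_le_sum fun t ht => ?_
        rw [← Finset.sum_filter]
        refine Finset.sum_le_sum_of_subset_of_nonneg (fun s hs => ?_) fun s _ _ => hd s
        have h1 := ha t ht
        simp only [Finset.mem_Ico, Finset.mem_Icc, Finset.mem_filter, Finset.mem_Ioc] at hs ht ⊢
        omega
    _ = ∑ s ∈ Finset.Icc 1 T, ∑ t ∈ Finset.Icc 1 T,
          if t ∈ Finset.Ioc s (s + K) then d s else 0 :=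
        Finset.sum_comm
    _ ≤ ∑ s ∈ Finset.Icc 1 T, K * d s := by
        refine Finset.sum_le_sum fun s _ => ?_
        rw [← Finset.sum_filter, Finset.sum_const, nsmul_eq_mul]
        refine mul_le_mul_of_nonneg_right ?_ (hd s)
        have : (Finset.filter (fun t => t ∈ Finset.Ioc s (s + K)) (Finset.Icc 1 T)).card ≤
            (Finset.Ioc s (s + K)).card :=
          Finset.card_le_card fun t ht => (Finset.mem_filter.1 ht).2
        rw [Nat.card_Ioc, Nat.add_sub_cancel_left] at this
        exact_mod_cast this
    _ = K * ∑ s ∈ Finset.Icc 1 T, d s := by rw [Finset.mul_sum]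

/-- Each term `1 - v_{t-1} / v_t` is at most `log (v_t / v_{t-1})`, and the logarithms telescope. -/
theorem sum_sub_div_le_log {v : ℕ → ℝ} (hv : ∀ t, 0 < v t) (T : ℕ) :
    ∑ t ∈ Finset.Icc 1 T, (v t - v (t - 1)) / v t ≤ Real.log (v T / v 0) := by
  induction T with
  | zero => simp [(hv 0).ne']
  | succ T ih =>
    rw [Finset.sum_Icc_succ_top (by omega), Nat.add_sub_cancel]
    have h1 := Real.one_sub_inv_le_log_of_pos (div_pos (hv (T + 1)) (hv T))
    have e1 : (v (T + 1) - v T) / v (T + 1) = 1 - (v (T + 1) / v T)⁻¹ := by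
      rw [inv_div, sub_div, div_self (hv _).ne']
    have e2 : Real.log (v (T + 1) / v 0) =
        Real.log (v T / v 0) + Real.log (v (T + 1) / v T) := by
      rw [Real.log_div (hv _).ne' (hv _).ne', Real.log_div (hv _).ne' (hv _).ne',
        Real.log_div (hv _).ne' (hv _).ne']
      ring
    rw [e1, e2]
    linarith

/-! ### Pathwise analysis of AdaGrad-norm -/

section Pathwise

variable {p : ℕ} {X Ω : Type*} [MeasurableSpace X] {π : Measure X}
  {ρ r L L₁ C α v₀ : ℝ} {Θ : Set (EuclideanSpace ℝ (Fin p))}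
  {f : EuclideanSpace ℝ (Fin p) → ℝ}
  {G : EuclideanSpace ℝ (Fin p) → X → EuclideanSpace ℝ (Fin p)}
  {x : ℕ → Ω → X} {θ : ℕ → Ω → EuclideanSpace ℝ (Fin p)} {v : ℕ → Ω → ℝ}
  {prox : EuclideanSpace ℝ (Fin p) → EuclideanSpace ℝ (Fin p)}

omit [MeasurableSpace X] in
theorem IsAdaGrad.mem (hA : IsAdaGrad Θ G α v₀ x θ v) {t : ℕ} (ht : 1 ≤ t) (ω : Ω) :
    θ t ω ∈ Θ := by
  obtain ⟨t, rfl⟩ := Nat.exists_eq_add_of_le' ht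
  rcases t with _ | t
  · obtain ⟨θ₁, h1, h2⟩ := hA.init
    rw [zero_add, h2]; exact h1
  · exact (hA.step (t + 1) (by omega) ω).1

omit [MeasurableSpace X] in
theorem IsAdaGrad.acc_mono (hA : IsAdaGrad Θ G α v₀ x θ v) (ω : Ω) :
    Monotone fun t => v t ω := by
  refine monotone_nat_of_le_succ fun t => ?_
  have := hA.acc (t + 1) (by omega) ω
  rw [Nat.add_sub_cancel] at this
  rw [this]
  linarith [sq_nonneg ‖G (θ (t + 1) ω) (x (t + 1 + 1) ω)‖]

omit [MeasurableSpace X] in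
theorem IsAdaGrad.le_acc (hA : IsAdaGrad Θ G α v₀ x θ v) (t : ℕ) (ω : Ω) : v₀ ≤ v t ω := by
  rw [← hA.init_acc ω]; exact hA.acc_mono ω (Nat.zero_le t)

theorem IsAdaGrad.acc_le (hA : IsAdaGrad Θ G α v₀ x θ v)
    (hP : ProblemAssumptions ρ L L₁ C Θ f G π) (t : ℕ) (ω : Ω) : v t ω ≤ v₀ + t * L ^ 2 := by
  induction t with
  | zero => simp [hA.init_acc ω]
  | succ t ih =>
    rw [hA.acc (t + 1) (by omega) ω, Nat.add_sub_cancel]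
    have h1 := hP.norm_le _ (hA.mem (t := t + 1) (by omega) ω) (x (t + 1 + 1) ω)
    have h2 : ‖G (θ (t + 1) ω) (x (t + 1 + 1) ω)‖ ^ 2 ≤ L ^ 2 := by gcongr
    push_cast
    linarith

/-- The length `α_t ‖G(θ_t, x_{t+1})‖` of the unprojected step at time `t`. -/
noncomputable def stepLength (G : EuclideanSpace ℝ (Fin p) → X → EuclideanSpace ℝ (Fin p)) (α : ℝ)
    (x : ℕ → Ω → X) (θ : ℕ → Ω → EuclideanSpace ℝ (Fin p)) (v : ℕ → Ω → ℝ) (t : ℕ) (ω : Ω) : ℝ :=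
  α / √(v t ω) * ‖G (θ t ω) (x (t + 1) ω)‖

omit [MeasurableSpace X] in
theorem stepLength_nonneg (hα : 0 < α) (t : ℕ) (ω : Ω) : 0 ≤ stepLength G α x θ v t ω :=
  mul_nonneg (div_nonneg hα.le (Real.sqrt_nonneg _)) (norm_nonneg _)

theorem IsAdaGrad.norm_sub_le (hA : IsAdaGrad Θ G α v₀ x θ v) (hα : 0 < α)
    (hP : ProblemAssumptions ρ L L₁ C Θ f G π) {t : ℕ} (ht : 1 ≤ t) (ω : Ω) :
    ‖θ (t + 1) ω - θ t ω‖ ≤ stepLength G α x θ v t ω := by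
  have h := (hA.step t ht ω).norm_sub_le hP.convex (isProjection_self (hA.mem ht ω))
  rw [sub_sub_cancel_left, norm_neg, norm_smul, Real.norm_eq_abs,
    abs_of_nonneg (div_nonneg hα.le (Real.sqrt_nonneg _))] at h
  exact h

theorem IsAdaGrad.norm_sub_le_sum (hA : IsAdaGrad Θ G α v₀ x θ v) (hα : 0 < α)
    (hP : ProblemAssumptions ρ L L₁ C Θ f G π) {s t : ℕ} (hs : 1 ≤ s) (hst : s ≤ t) (ω : Ω) :
    ‖θ t ω - θ s ω‖ ≤ ∑ i ∈ Finset.Ico s t, stepLength G α x θ v i ω := by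
  induction t, hst using Nat.le_induction with
  | base => simp
  | succ t hst ih =>
    rw [Finset.sum_Ico_succ_top hst]
    have h := hA.norm_sub_le hα hP (hs.trans hst) ω
    have := norm_sub_le_norm_sub_add_norm_sub (θ (t + 1) ω) (θ t ω) (θ s ω)
    linarith

/-- By Cauchy–Schwarz and the logarithmic bound on the sum of the squared step lengths, the total
length of the path up to time `T` is of order `√(T log T)`. -/
theorem IsAdaGrad.sum_stepLength_le (hA : IsAdaGrad Θ G α v₀ x θ v) (hα : 0 < α) (hv₀ : 0 < v₀)
    (hP : ProblemAssumptions ρ L L₁ C Θ f G π) (T : ℕ) (ω : Ω) :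
    ∑ t ∈ Finset.Icc 1 T, stepLength G α x θ v t ω ≤
      √T * (α * √(Real.log (1 + v₀⁻¹ * T * L ^ 2))) := by
  have hv : ∀ t, 0 < v t ω := fun t => hv₀.trans_le (hA.le_acc t ω)
  have h1 : ∑ t ∈ Finset.Icc 1 T, stepLength G α x θ v t ω ^ 2 ≤
      α ^ 2 * Real.log (1 + v₀⁻¹ * T * L ^ 2) := by
    have e : ∀ t ∈ Finset.Icc 1 T,
        stepLength G α x θ v t ω ^ 2 = α ^ 2 * ((v t ω - v (t - 1) ω) / v t ω) := by
      intro t ht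
      have h := hA.acc t (Finset.mem_Icc.1 ht).1 ω
      rw [stepLength, mul_pow, div_pow, Real.sq_sqrt (hv t).le]
      rw [show v t ω - v (t - 1) ω = ‖G (θ t ω) (x (t + 1) ω)‖ ^ 2 by linarith]
      ring
    rw [Finset.sum_congr rfl e, ← Finset.mul_sum]
    refine mul_le_mul_of_nonneg_left ?_ (sq_nonneg α)
    refine (sum_sub_div_le_log hv T).trans ?_
    refine Real.log_le_log (div_pos (hv _) (hv _)) ?_
    rw [hA.init_acc, div_le_iff₀ hv₀]
    have := hA.acc_le hP T ω
    have e2 : (1 + v₀⁻¹ * T * L ^ 2) * v₀ = v₀ + T * L ^ 2 := by field_simp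
    rw [e2]; exact this
  have h2 := sq_sum_le_card_mul_sum_sq (s := Finset.Icc 1 T)
    (f := fun t => stepLength G α x θ v t ω)
  rw [Nat.card_Icc, Nat.add_sub_cancel] at h2
  have hlog : 0 ≤ Real.log (1 + v₀⁻¹ * T * L ^ 2) := by
    refine Real.log_nonneg ?_
    have : 0 ≤ v₀⁻¹ * T * L ^ 2 := by positivity
    linarith
  refine le_of_sq_le_sq ?_ (by positivity)
  rw [mul_pow, mul_pow, Real.sq_sqrt (Nat.cast_nonneg T), Real.sq_sqrt hlog]
  exact h2.trans (mul_le_mul_of_nonneg_left h1 (Nat.cast_nonneg T))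

theorem abs_moreauEnvelope_le (hP : ProblemAssumptions ρ L L₁ C Θ f G π) (hr : 0 < r)
    {z y : EuclideanSpace ℝ (Fin p)} (hy : IsProxPoint Θ f r z y) (hz : z ∈ Θ) :
    |moreauEnvelope Θ f (1 / r) z| ≤ C := by
  have h1 := hy.moreauEnvelope_le hz
  have h2 := hy.moreauEnvelope_eq
  have h3 := abs_le.1 (hP.abs_le z hz)
  have h4 := abs_le.1 (hP.abs_le y hy.1)
  have h5 : 0 ≤ r / 2 * ‖y - z‖ ^ 2 := by positivity
  rw [sub_self, norm_zero] at h1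
  exact abs_le.2 ⟨by linarith, by linarith⟩

/-- One step of the method decreases the Moreau envelope up to second order. -/
theorem IsAdaGrad.inner_le (hA : IsAdaGrad Θ G α v₀ x θ v) (hα : 0 < α) (hv₀ : 0 < v₀)
    (hr : 0 < r) (hP : ProblemAssumptions ρ L L₁ C Θ f G π)
    (hp : ∀ z, IsProxPoint Θ f r z (prox z)) {t : ℕ} (ht : 1 ≤ t) (ω : Ω) :
    r * inner ℝ (θ t ω - prox (θ t ω)) (G (θ t ω) (x (t + 1) ω)) ≤
      (moreauEnvelope Θ f (1 / r) (θ t ω) - moreauEnvelope Θ f (1 / r) (θ (t + 1) ω)) *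
        (√(v t ω) / α) + r / 2 * L * stepLength G α x θ v t ω := by
  set a := θ t ω
  set g := G a (x (t + 1) ω)
  have hsq : 0 < √(v t ω) := Real.sqrt_pos.2 (hv₀.trans_le (hA.le_acc t ω))
  set η := α / √(v t ω) with hη
  have hη0 : 0 < η := div_pos hα hsq
  have h1 := (hp (θ (t + 1) ω)).moreauEnvelope_le (hp a).1
  have h2 := (isProjection_self (hp a).1).norm_sub_le hP.convex (hA.step t ht ω)
  have h3 : r / 2 * ‖prox a - θ (t + 1) ω‖ ^ 2 ≤ r / 2 * ‖prox a - (a - η • g)‖ ^ 2 := by gcongr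
  have e : prox a - (a - η • g) = (prox a - a) + η • g := by abel
  rw [e, norm_add_sq_real, real_inner_smul_right, norm_smul, Real.norm_eq_abs, abs_of_pos hη0,
    ← neg_sub a (prox a), inner_neg_left, norm_neg] at h3
  have h4 := (hp a).moreauEnvelope_eq
  rw [norm_sub_rev] at h4
  have h5 : ‖g‖ ≤ L := hP.norm_le a (hA.mem ht ω) _
  have h6 : r / 2 * η * ‖g‖ ^ 2 ≤ r / 2 * L * (η * ‖g‖) := by
    rw [pow_two]
    calc r / 2 * η * (‖g‖ * ‖g‖) = r / 2 * (η * ‖g‖) * ‖g‖ := by ring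
      _ ≤ r / 2 * (η * ‖g‖) * L := by gcongr
      _ = _ := by ring
  have h7 : η * (r * inner ℝ (a - prox a) g) ≤ η *
      ((moreauEnvelope Θ f (1 / r) a - moreauEnvelope Θ f (1 / r) (θ (t + 1) ω)) *
        (√(v t ω) / α) + r / 2 * η * ‖g‖ ^ 2) := by
    have e3 : η * (√(v t ω) / α) = 1 := by rw [hη]; field_simp
    rw [mul_add, mul_left_comm η (_ - _), e3]
    nlinarith
  exact (le_of_mul_le_mul_left h7 hη0).trans (by rw [stepLength]; linarith)

/-- Dividing the descent inequality by the random step size before summing leads to a telescoping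
sum with nondecreasing weights `√v_t / α`. -/
theorem IsAdaGrad.sum_inner_le (hA : IsAdaGrad Θ G α v₀ x θ v) (hα : 0 < α) (hv₀ : 0 < v₀)
    (hr : 0 < r) (hP : ProblemAssumptions ρ L L₁ C Θ f G π) (hC : 0 < C)
    (hp : ∀ z, IsProxPoint Θ f r z (prox z)) {T : ℕ} (hT : 1 ≤ T) (ω : Ω) :
    ∑ t ∈ Finset.Icc 1 T, inner ℝ (θ t ω - prox (θ t ω)) (G (θ t ω) (x (t + 1) ω)) ≤
      2 * C * √(v₀ + T * L ^ 2) / (α * r)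
        + L / 2 * ∑ t ∈ Finset.Icc 1 T, stepLength G α x θ v t ω := by
  have h1 := Finset.sum_le_sum fun t (ht : t ∈ Finset.Icc 1 T) =>
    hA.inner_le hα hv₀ hr hP hp (Finset.mem_Icc.1 ht).1 ω
  rw [← Finset.mul_sum, Finset.sum_add_distrib, ← Finset.mul_sum] at h1
  have h2 := sum_sub_mul_le_of_monotone
    (e := fun t => moreauEnvelope Θ f (1 / r) (θ t ω)) (b := fun t => √(v t ω) / α) (C := C)
    (fun t ht => abs_moreauEnvelope_le hP hr (hp _) (hA.mem ht ω))
    (fun t _ => div_nonneg (Real.sqrt_nonneg _) hα.le)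
    (fun t _ => div_le_div_of_nonneg_right
      (Real.sqrt_le_sqrt (hA.acc_mono ω (Nat.le_succ t))) hα.le) hT
  have h3 : 2 * C * (√(v T ω) / α) ≤ 2 * C * (√(v₀ + T * L ^ 2) / α) := by
    have := hA.acc_le hP T ω
    gcongr
  have h4 : r * (2 * C * √(v₀ + T * L ^ 2) / (α * r)) = 2 * C * (√(v₀ + T * L ^ 2) / α) := by
    field_simp
  refine le_of_mul_le_mul_left ?_ hr
  rw [mul_add, h4]
  linarith

/-! ### The bias of the stochastic subgradients -/

theorem ProblemAssumptions.integrable [IsFiniteMeasure π]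
    (hP : ProblemAssumptions ρ L L₁ C Θ f G π) {a : EuclideanSpace ℝ (Fin p)} (ha : a ∈ Θ) :
    Integrable (G a) π :=
  Integrable.of_bound (hP.measurable a ha).aestronglyMeasurable L (ae_of_all _ (hP.norm_le a ha))

variable [IsProbabilityMeasure π]

theorem ProblemAssumptions.norm_mean_le (hP : ProblemAssumptions ρ L L₁ C Θ f G π)
    {a : EuclideanSpace ℝ (Fin p)} (ha : a ∈ Θ) : ‖∫ ξ, G a ξ ∂π‖ ≤ L := by
  simpa using norm_integral_le_of_norm_le_const (μ := π) (ae_of_all _ (hP.norm_le a ha))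

theorem ProblemAssumptions.norm_mean_sub_le (hP : ProblemAssumptions ρ L L₁ C Θ f G π)
    {a b : EuclideanSpace ℝ (Fin p)} (ha : a ∈ Θ) (hb : b ∈ Θ) :
    ‖∫ ξ, G a ξ ∂π - ∫ ξ, G b ξ ∂π‖ ≤ L₁ * ‖a - b‖ := by
  rw [← integral_sub (hP.integrable ha) (hP.integrable hb)]
  simpa using norm_integral_le_of_norm_le_const (μ := π) (f := fun ξ => G a ξ - G b ξ)
    (ae_of_all _ fun ξ => hP.lipschitz ξ a ha b hb)

theorem ProblemAssumptions.exists_prox (hP : ProblemAssumptions ρ L L₁ C Θ f G π)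
    (hne : Θ.Nonempty) (hr : 0 < r) : ∃ prox : EuclideanSpace ℝ (Fin p) → EuclideanSpace ℝ (Fin p),
      ∀ z, IsProxPoint Θ f r z (prox z) := by
  have hc : ContinuousOn f Θ := hP.weaklyConvex.continuousOn (L := L) fun a ha =>
    ⟨_, hP.mean_mem_subdifferential a ha, hP.norm_mean_le ha⟩
  exact Classical.skolem.1 fun z => exists_isProxPoint hP.isClosed hne hc hP.abs_le hr z

theorem ProblemAssumptions.norm_residual_le (hP : ProblemAssumptions ρ L L₁ C Θ f G π)
    (hr : ρ < r) {z y : EuclideanSpace ℝ (Fin p)} (hy : IsProxPoint Θ f r z y) (hz : z ∈ Θ) :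
    ‖z - y‖ ≤ L / (r - ρ) :=
  hy.norm_residual_le hP.weaklyConvex hr hz (hP.mean_mem_subdifferential z hz)
    (hP.norm_mean_le hz)

/-- The correlation of the residual with the error of the subgradient estimate, at a frozen sample,
is Lipschitz in the iterate. -/
theorem ProblemAssumptions.inner_mean_sub_le (hP : ProblemAssumptions ρ L L₁ C Θ f G π)
    (hρ : 0 ≤ ρ) (hr : ρ < r) (hp : ∀ z, IsProxPoint Θ f r z (prox z))
    {a b : EuclideanSpace ℝ (Fin p)} (ha : a ∈ Θ) (hb : b ∈ Θ) (ξ : X) :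
    inner ℝ (a - prox a) ((∫ η, G a η ∂π) - G a ξ) ≤
      inner ℝ (b - prox b) ((∫ η, G b η ∂π) - G b ξ)
        + 2 * L * (L₁ + r) / (r - ρ) * ‖a - b‖ := by
  set A := (∫ η, G a η ∂π) - G a ξ with hA
  set B := (∫ η, G b η ∂π) - G b ξ with hB
  have hd : 0 < r - ρ := sub_pos.2 hr
  have h1 := (hp a).norm_residual_sub_le hP.weaklyConvex hρ hr (hp b)
  have h2 := hP.norm_residual_le hr (hp b) hb
  have h3 : ‖A‖ ≤ 2 * L := by
    have := norm_sub_le (∫ η, G a η ∂π) (G a ξ)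
    linarith [hP.norm_mean_le ha, hP.norm_le a ha ξ]
  have h4 : ‖A - B‖ ≤ 2 * L₁ * ‖a - b‖ := by
    have e : A - B = ((∫ η, G a η ∂π) - ∫ η, G b η ∂π) - (G a ξ - G b ξ) := by
      rw [hA, hB]; abel
    have := norm_sub_le ((∫ η, G a η ∂π) - ∫ η, G b η ∂π) (G a ξ - G b ξ)
    rw [e]
    linarith [hP.norm_mean_sub_le ha hb, hP.lipschitz ξ a ha b hb]
  have e : inner ℝ (a - prox a) A = inner ℝ (b - prox b) B
      + inner ℝ ((a - prox a) - (b - prox b)) A + inner ℝ (b - prox b) (A - B) := by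
    rw [inner_sub_left (a - prox a) (b - prox b) A, inner_sub_right (b - prox b) A B]; ring
  have h5 : inner ℝ ((a - prox a) - (b - prox b)) A ≤ (r / (r - ρ) * ‖a - b‖) * (2 * L) :=
    (real_inner_le_norm _ _).trans (mul_le_mul h1 h3 (norm_nonneg _) ((norm_nonneg _).trans h1))
  have h6 : inner ℝ (b - prox b) (A - B) ≤ L / (r - ρ) * (2 * L₁ * ‖a - b‖) :=
    (real_inner_le_norm _ _).trans (mul_le_mul h2 h4 (norm_nonneg _) ((norm_nonneg _).trans h2))
  have e2 : 2 * L * (L₁ + r) / (r - ρ) * ‖a - b‖ =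
      (r / (r - ρ) * ‖a - b‖) * (2 * L) + L / (r - ρ) * (2 * L₁ * ‖a - b‖) := by ring
  rw [e, e2]
  linarith

/-- Pathwise bound on the squared residuals. In the bias term at time `t` the iterate is frozen at
time `t - k t`; when this is `0`, the initial point `θ₁` is used, since `θ₀` is meaningless. -/
theorem IsAdaGrad.sum_norm_sq_le (hA : IsAdaGrad Θ G α v₀ x θ v) (hα : 0 < α) (hv₀ : 0 < v₀)
    (hρ : 0 ≤ ρ) (hr : ρ < r) (hL : 0 ≤ L) (hL₁ : 0 ≤ L₁)
    (hP : ProblemAssumptions ρ L L₁ C Θ f G π)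
    (hC : 0 < C) (hp : ∀ z, IsProxPoint Θ f r z (prox z)) {T : ℕ} (hT : 1 ≤ T) {k : ℕ → ℕ}
    (hk : MonotoneOn k (Set.Ici 1)) (ω : Ω) :
    (r - ρ) * ∑ t ∈ Finset.Icc 1 T, ‖θ t ω - prox (θ t ω)‖ ^ 2 ≤
      2 * C * √(v₀ + T * L ^ 2) / (α * r)
        + (L / 2 + 2 * L * (L₁ + r) / (r - ρ) * k T) *
          (√T * (α * √(Real.log (1 + v₀⁻¹ * T * L ^ 2))))
        + ∑ t ∈ Finset.Icc 1 T, inner ℝ (θ (max (t - k t) 1) ω - prox (θ (max (t - k t) 1) ω))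
            ((∫ ξ, G (θ (max (t - k t) 1) ω) ξ ∂π)
              - G (θ (max (t - k t) 1) ω) (x (t + 1) ω)) := by
  have hr0 : 0 < r := hρ.trans_lt hr
  have hd : 0 < r - ρ := sub_pos.2 hr
  set S := ∑ t ∈ Finset.Icc 1 T, stepLength G α x θ v t ω
  have hS := hA.sum_stepLength_le hα hv₀ hP T ω
  set D := 2 * L * (L₁ + r) / (r - ρ) with hD
  have hD0 : 0 ≤ D := by positivity
  have h1 := hA.sum_inner_le hα hv₀ hr0 hP hC hp hT ω
  have h2 : ∑ t ∈ Finset.Icc 1 T, ‖θ t ω - θ (max (t - k t) 1) ω‖ ≤ k T * S := by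
    refine (Finset.sum_le_sum fun t ht => hA.norm_sub_le_sum hα hP (le_max_right _ _) ?_ ω).trans
      (sum_window_le (fun s => stepLength_nonneg hα s ω) fun t ht => ⟨le_max_right _ _, ?_⟩)
    · have := (Finset.mem_Icc.1 ht).1
      omega
    · have ht' := Finset.mem_Icc.1 ht
      have := hk (Set.mem_Ici.2 ht'.1) (Set.mem_Ici.2 hT) ht'.2
      omega
  have h3 : ∀ t ∈ Finset.Icc 1 T, (r - ρ) * ‖θ t ω - prox (θ t ω)‖ ^ 2 ≤
      inner ℝ (θ t ω - prox (θ t ω)) (G (θ t ω) (x (t + 1) ω))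
      + D * ‖θ t ω - θ (max (t - k t) 1) ω‖
      + inner ℝ (θ (max (t - k t) 1) ω - prox (θ (max (t - k t) 1) ω))
            ((∫ ξ, G (θ (max (t - k t) 1) ω) ξ ∂π)
              - G (θ (max (t - k t) 1) ω) (x (t + 1) ω)) := by
    intro t ht
    have hmem := hA.mem (Finset.mem_Icc.1 ht).1 ω
    have i1 := (hp (θ t ω)).mul_norm_sq_le_inner hP.weaklyConvex hmem
      (hP.mean_mem_subdifferential _ hmem)
    have i2 := hP.inner_mean_sub_le hρ hr hp hmem
      (hA.mem (le_max_right (t - k t) 1) ω) (x (t + 1) ω)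
    rw [inner_sub_right] at i2
    rw [real_inner_comm] at i1
    linarith
  have h4 := Finset.sum_le_sum h3
  rw [← Finset.mul_sum, Finset.sum_add_distrib, Finset.sum_add_distrib, ← Finset.mul_sum] at h4
  have h5 := mul_le_mul_of_nonneg_left h2 hD0
  have h6 : (L / 2 + D * k T) * S ≤ (L / 2 + D * k T) *
      (√T * (α * √(Real.log (1 + v₀⁻¹ * T * L ^ 2)))) :=
    mul_le_mul_of_nonneg_left hS (by positivity)
  linarith

end Pathwise

/-! ### Measurability of the iterates -/

section Expectation

variable {p : ℕ} {X Ω : Type*} [MeasurableSpace X] [MeasurableSpace Ω] {P : Measure Ω}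
  {π : Measure X} {κ : ∀ n : ℕ, Kernel (Fin n → X) X}
  {ρ r L L₁ C α v₀ : ℝ} {Θ : Set (EuclideanSpace ℝ (Fin p))}
  {f : EuclideanSpace ℝ (Fin p) → ℝ}
  {G : EuclideanSpace ℝ (Fin p) → X → EuclideanSpace ℝ (Fin p)}
  {x : ℕ → Ω → X} {θ : ℕ → Ω → EuclideanSpace ℝ (Fin p)} {v : ℕ → Ω → ℝ}
  {θout : Ω → EuclideanSpace ℝ (Fin p)}
  {prox : EuclideanSpace ℝ (Fin p) → EuclideanSpace ℝ (Fin p)}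

/-- `G` is a Carathéodory function on `Θ × X`, hence jointly measurable. -/
theorem ProblemAssumptions.measurable_uncurry (hP : ProblemAssumptions ρ L L₁ C Θ f G π) :
    Measurable fun q : Θ × X => G q.1 q.2 := by
  refine measurable_uncurry_of_continuous_of_measurable (u := fun (a : Θ) ξ => G a ξ)
    (fun ξ => ?_) fun a => hP.measurable a a.2
  exact (LipschitzWith.of_dist_le' (K := L₁) fun a b => by
    rw [dist_eq_norm, Subtype.dist_eq, dist_eq_norm]
    exact hP.lipschitz ξ a a.2 b b.2).continuous

theorem exists_continuous_projection (hΘ : IsClosed Θ) (hconv : Convex ℝ Θ) (hne : Θ.Nonempty) :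
    ∃ proj : EuclideanSpace ℝ (Fin p) → EuclideanSpace ℝ (Fin p),
      Continuous proj ∧ ∀ z, IsProjection Θ z (proj z) := by
  have h : ∀ z, ∃ y, IsProjection Θ z y := by
    intro z
    obtain ⟨y, hy⟩ := exists_isProxPoint (f := fun _ => 0) (C := 0) (r := 1) hΘ hne
      continuousOn_const (by simp) one_pos z
    refine ⟨y, hy.1, fun w hw => ?_⟩
    have := hy.2 w hw
    rw [norm_sub_rev z, norm_sub_rev z]
    exact le_of_sq_le_sq (by linarith) (norm_nonneg _)
  choose proj hproj using h
  refine ⟨proj, ?_, hproj⟩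
  exact (LipschitzWith.of_dist_le' (K := 1) fun a b => by
    rw [dist_eq_norm, dist_eq_norm, one_mul]
    exact (hproj a).norm_sub_le hconv (hproj b)).continuous

omit [MeasurableSpace X] [MeasurableSpace Ω] in
theorem IsProjection.unique (hconv : Convex ℝ Θ) {z y y' : EuclideanSpace ℝ (Fin p)}
    (h : IsProjection Θ z y) (h' : IsProjection Θ z y') : y = y' := by
  have := h.norm_sub_le hconv h'
  rw [sub_self, norm_zero] at this
  exact sub_eq_zero.1 (norm_le_zero_iff.1 this)

omit [MeasurableSpace Ω] in
/-- `θ_t` and `v_{t-1}` are measurable functions of `(x₁, …, x_t)`. -/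
theorem IsAdaGrad.exists_measurable_state (hA : IsAdaGrad Θ G α v₀ x θ v)
    (hP : ProblemAssumptions ρ L L₁ C Θ f G π) {t : ℕ} (ht : 1 ≤ t) :
    ∃ F : (Fin t → X) → Θ × ℝ, Measurable F ∧
      ∀ ω, θ t ω = (F (history x t ω)).1 ∧ v (t - 1) ω = (F (history x t ω)).2 := by
  obtain ⟨θ₁, h1, h2⟩ := hA.init
  obtain ⟨proj, hcont, hproj⟩ := exists_continuous_projection hP.isClosed hP.convex ⟨θ₁, h1⟩
  induction t, ht using Nat.le_induction with
  | base => exact ⟨fun _ => (⟨θ₁, h1⟩, v₀), measurable_const, fun ω => ⟨h2 ω, hA.init_acc ω⟩⟩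
  | succ t ht ih =>
    obtain ⟨F, hF, hFω⟩ := ih
    have hinit : Measurable fun q : Fin (t + 1) → X => F fun i => q i.castSucc :=
      hF.comp (measurable_pi_lambda _ fun i => measurable_pi_apply _)
    let g : (Fin (t + 1) → X) → EuclideanSpace ℝ (Fin p) := fun q =>
      G (F fun i => q i.castSucc).1 (q (Fin.last t))
    have hg : Measurable g :=
      hP.measurable_uncurry.comp (hinit.fst.prodMk (measurable_pi_apply (Fin.last t)))
    let V : (Fin (t + 1) → X) → ℝ := fun q => (F fun i => q i.castSucc).2 + ‖g q‖ ^ 2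
    have hV : Measurable V := hinit.snd.add (hg.norm.pow_const 2)
    have hstep : Measurable fun q => proj ((F fun i => q i.castSucc).1 - (α / √(V q)) • g q) := by
      refine hcont.measurable.comp ?_
      exact (measurable_subtype_coe.comp hinit.fst).sub
        ((measurable_const.div hV.sqrt).smul hg)
    refine ⟨fun q => (⟨proj ((F fun i => q i.castSucc).1 - (α / √(V q)) • g q), (hproj _).1⟩, V q),
      (hstep.subtype_mk).prodMk hV, fun ω => ?_⟩
    have e1 : F (fun i : Fin t => history x (t + 1) ω i.castSucc) = F (history x t ω) := rfl
    have e2 : g (history x (t + 1) ω) = G (θ t ω) (x (t + 1) ω) := by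
      simp only [g, e1, ← (hFω ω).1]
      rfl
    have e3 : V (history x (t + 1) ω) = v t ω := by
      simp only [V, e1, e2, ← (hFω ω).2, hA.acc t ht ω]
    refine ⟨?_, ?_⟩
    · simp only [e1, e2, e3, ← (hFω ω).1]
      exact (hA.step t ht ω).unique hP.convex (hproj _)
    · rw [Nat.add_sub_cancel]; exact e3.symm

omit [MeasurableSpace Ω] in
theorem IsAdaGrad.exists_measurable_iterate (hA : IsAdaGrad Θ G α v₀ x θ v)
    (hP : ProblemAssumptions ρ L L₁ C Θ f G π) (m : ℕ) :
    ∃ F : (Fin m → X) → Θ, Measurable F ∧ ∀ ω, θ (max m 1) ω = F (history x m ω) := by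
  rcases m with _ | m
  · obtain ⟨θ₁, h1, h2⟩ := hA.init
    exact ⟨fun _ => ⟨θ₁, h1⟩, measurable_const, fun ω => h2 ω⟩
  · obtain ⟨F, hF, hFω⟩ := hA.exists_measurable_state hP (t := m + 1) (by omega)
    exact ⟨fun q => (F q).1, hF.fst, fun ω => by
      rw [max_eq_left (by omega : 1 ≤ m + 1)]; exact (hFω ω).1⟩

omit [MeasurableSpace Ω] [MeasurableSpace X] in
theorem continuous_residual (hf : WeaklyConvexOn ρ Θ f) (hρ : 0 ≤ ρ) (hr : ρ < r)
    (hp : ∀ z, IsProxPoint Θ f r z (prox z)) : Continuous fun z => z - prox z :=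
  (LipschitzWith.of_dist_le' (K := r / (r - ρ)) fun a b => by
    rw [dist_eq_norm, dist_eq_norm]
    exact (hp a).norm_residual_sub_le hf hρ hr (hp b)).continuous

/-! ### Bounds in expectation -/

/-- Conditionally on the first `m` samples the iterate `θ_m` is frozen, so the mean error of the
subgradient estimate at `θ_m` with the sample `x_{m+1+j}` is controlled by mixing. For `m = 0` the
deterministic `θ₁` takes the place of `θ_m`. -/
theorem IsAdaGrad.integral_bias_le [IsProbabilityMeasure P] [IsProbabilityMeasure π]
    [∀ n, IsMarkovKernel (κ n)] (hA : IsAdaGrad Θ G α v₀ x θ v) (hx : IsSampledFrom κ P x)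
    (hP : ProblemAssumptions ρ L L₁ C Θ f G π) (hρ : 0 ≤ ρ) (hr : ρ < r)
    (hp : ∀ z, IsProxPoint Θ f r z (prox z)) (j m : ℕ) :
    Integrable (fun ω => (inner ℝ (θ (max m 1) ω - prox (θ (max m 1) ω))
      ((∫ ξ, G (θ (max m 1) ω) ξ ∂π) - G (θ (max m 1) ω) (x (m + 1 + j) ω)) : ℝ)) P ∧
    ∫ ω, inner ℝ (θ (max m 1) ω - prox (θ (max m 1) ω))
      ((∫ ξ, G (θ (max m 1) ω) ξ ∂π) - G (θ (max m 1) ω) (x (m + 1 + j) ω)) ∂P ≤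
      2 * (L / (r - ρ) * L) * mixingCoeff κ π m (m + 1 + j) := by
  obtain ⟨F, hF, hFω⟩ := hA.exists_measurable_iterate hP m
  let ψ : (Fin m → X) × X → ℝ := fun q =>
    inner ℝ ((F q.1 : EuclideanSpace ℝ (Fin p)) - prox (F q.1)) (G (F q.1) q.2)
  have hψ : Measurable ψ := by
    refine Measurable.inner ?_ ?_
    · exact (continuous_residual hP.weaklyConvex hρ hr hp).measurable.comp
        (measurable_subtype_coe.comp (hF.comp measurable_fst))
    · exact hP.measurable_uncurry.comp ((hF.comp measurable_fst).prodMk measurable_snd)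
  have hB : ∀ q, |ψ q| ≤ L / (r - ρ) * L := fun q => by
    have h1 := hP.norm_residual_le hr (hp (F q.1)) (F q.1).2
    exact (abs_real_inner_le_norm _ _).trans (mul_le_mul h1 (hP.norm_le _ (F q.1).2 _)
      (norm_nonneg _) ((norm_nonneg _).trans h1))
  have key := (abs_le.1 (hx.abs_integral_sub_le (π := π) j m hψ hB)).1
  have hH := hx.measurable_history m
  have hY : Measurable (x (m + 1 + j)) := hx.measurable _ (by omega)
  have hi1 : Integrable (fun ω => ψ (history x m ω, x (m + 1 + j) ω)) P :=
    Integrable.of_bound (hψ.comp (hH.prodMk hY)).aestronglyMeasurable _ (ae_of_all _ fun ω => hB _)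
  have hm2 : Measurable fun h => ∫ ξ, ψ (h, ξ) ∂π :=
    (hψ.stronglyMeasurable.integral_prod_right' (ν := π)).measurable
  have hi2 : Integrable (fun ω => ∫ ξ, ψ (history x m ω, ξ) ∂π) P := by
    refine Integrable.of_bound (hm2.comp hH).aestronglyMeasurable (L / (r - ρ) * L)
      (ae_of_all _ fun ω => ?_)
    simpa using norm_integral_le_of_norm_le_const (μ := π)
      (f := fun ξ => ψ (history x m ω, ξ)) (ae_of_all _ fun ξ => hB (history x m ω, ξ))
  have e : (fun ω => (inner ℝ (θ (max m 1) ω - prox (θ (max m 1) ω))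
      ((∫ ξ, G (θ (max m 1) ω) ξ ∂π) - G (θ (max m 1) ω) (x (m + 1 + j) ω)) : ℝ)) =
      fun ω => (∫ ξ, ψ (history x m ω, ξ) ∂π) - ψ (history x m ω, x (m + 1 + j) ω) := by
    funext ω
    simp only [ψ]
    rw [integral_inner (hP.integrable (F (history x m ω)).2), inner_sub_right, hFω ω]
  rw [e]
  refine ⟨hi2.sub hi1, ?_⟩
  rw [integral_sub hi2 hi1]
  linarith

theorem IsAdaGrad.integrable_norm_sq [IsFiniteMeasure P] [IsProbabilityMeasure π]
    (hA : IsAdaGrad Θ G α v₀ x θ v) (hx : IsSampledFrom κ P x)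
    (hP : ProblemAssumptions ρ L L₁ C Θ f G π) (hρ : 0 ≤ ρ) (hr : ρ < r)
    (hp : ∀ z, IsProxPoint Θ f r z (prox z)) {t : ℕ} (ht : 1 ≤ t) :
    Integrable (fun ω => ‖θ t ω - prox (θ t ω)‖ ^ 2) P := by
  obtain ⟨F, hF, hFω⟩ := hA.exists_measurable_iterate hP t
  rw [max_eq_left ht] at hFω
  have hm : Measurable (θ t) := by
    rw [funext hFω]
    exact measurable_subtype_coe.comp (hF.comp (hx.measurable_history t))
  refine Integrable.of_bound (((continuous_residual hP.weaklyConvex hρ hr hp).measurable.comp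
    hm).norm.pow_const 2).aestronglyMeasurable ((L / (r - ρ)) ^ 2) (ae_of_all _ fun ω => ?_)
  rw [Real.norm_eq_abs, abs_of_nonneg (sq_nonneg _)]
  have := hP.norm_residual_le hr (hp (θ t ω)) (hA.mem ht ω)
  gcongr

/-- The averaged bound on the squared gradients. In the scalar inequality at the end, with
`y = α √(log (1 + T L² / v₀))`, the slack `c k (1 - y)²` of `2 y ≤ 1 + y²` absorbs the
second-order term of the descent inequality, which carries a factor `α`. -/
theorem IsAdaGrad.average_le [IsProbabilityMeasure P] [IsProbabilityMeasure π]
    [∀ n, IsMarkovKernel (κ n)] (hA : IsAdaGrad Θ G α v₀ x θ v) (hx : IsSampledFrom κ P x)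
    (hP : ProblemAssumptions ρ L L₁ C Θ f G π) (hα : 0 < α) (hv₀ : 0 < v₀) (hρ : 0 < ρ)
    (hr : ρ < r) (hL : 0 < L) (hL₁ : 0 < L₁) (hC : 0 < C)
    (hp : ∀ z, IsProxPoint Θ f r z (prox z)) {T : ℕ} (hT : 1 ≤ T) {k : ℕ → ℕ}
    (hk : MonotoneOn k (Set.Ici 1)) (hk1 : ∀ t, 1 ≤ t → 1 ≤ k t ∧ k t ≤ t) :
    1 / (T : ℝ) * ∑ t ∈ Finset.Icc 1 T, ∫ ω, r ^ 2 * ‖θ t ω - prox (θ t ω)‖ ^ 2 ∂P ≤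
      adagradBound ρ r L L₁ C α v₀ T (k T)
        (∑ t ∈ Finset.Icc 1 T, mixingCoeff κ π (t - k t) (t + 1)) := by
  have hd : 0 < r - ρ := sub_pos.2 hr
  have hr0 : 0 < r := hρ.trans hr
  have hT0 : (0 : ℝ) < T := by exact_mod_cast hT
  have hint := fun t (ht : t ∈ Finset.Icc 1 T) =>
    hA.integrable_norm_sq hx hP hρ.le hr hp (Finset.mem_Icc.1 ht).1
  have hbias : ∀ t ∈ Finset.Icc 1 T, _ := fun t ht =>
    hA.integral_bias_le hx hP hρ.le hr hp (k t) (t - k t)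
  have htime : ∀ t ∈ Finset.Icc 1 T, t - k t + 1 + k t = t + 1 := fun t ht => by
    have := hk1 t (Finset.mem_Icc.1 ht).1
    omega
  set y := α * √(Real.log (1 + v₀⁻¹ * T * L ^ 2)) with hy
  set ℓ := Real.log (1 + v₀⁻¹ * T * L ^ 2)
  set S := ∑ t ∈ Finset.Icc 1 T, mixingCoeff κ π (t - k t) (t + 1)
  set R := 2 * C * √(v₀ + T * L ^ 2) / (α * r)
        + (L / 2 + 2 * L * (L₁ + r) / (r - ρ) * k T) * (√T * y) with hR
  let b : ℕ → Ω → ℝ := fun t ω =>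
    inner ℝ (θ (max (t - k t) 1) ω - prox (θ (max (t - k t) 1) ω))
      ((∫ ξ, G (θ (max (t - k t) 1) ω) ξ ∂π) - G (θ (max (t - k t) 1) ω) (x (t + 1) ω))
  have hb1 : ∀ t ∈ Finset.Icc 1 T, Integrable (b t) P := fun t ht => by
    have := (hbias t ht).1
    rw [htime t ht] at this
    exact this
  have hb2 : ∀ t ∈ Finset.Icc 1 T,
      ∫ ω, b t ω ∂P ≤ 2 * (L / (r - ρ) * L) * mixingCoeff κ π (t - k t) (t + 1) := fun t ht => by
    have := (hbias t ht).2
    rw [htime t ht] at this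
    exact this
  have main : (r - ρ) * ∑ t ∈ Finset.Icc 1 T, ∫ ω, ‖θ t ω - prox (θ t ω)‖ ^ 2 ∂P ≤
      R + 2 * (L / (r - ρ) * L) * S := by
    have h1 : ∫ ω, (r - ρ) * ∑ t ∈ Finset.Icc 1 T, ‖θ t ω - prox (θ t ω)‖ ^ 2 ∂P ≤
        ∫ ω, (R + ∑ t ∈ Finset.Icc 1 T, b t ω) ∂P :=
      integral_mono ((integrable_finsetSum _ hint).const_mul _)
        ((integrable_const R).add (integrable_finsetSum _ hb1)) fun ω =>
        hA.sum_norm_sq_le hα hv₀ hρ.le hr hL.le hL₁.le hP hC hp hT hk ω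
    rw [integral_const_mul, integral_finsetSum _ hint,
      integral_add (integrable_const R) (integrable_finsetSum _ hb1),
      integral_finsetSum _ hb1, integral_const, probReal_univ, one_smul] at h1
    have h2 := Finset.sum_le_sum hb2
    rw [← Finset.mul_sum] at h2
    linarith
  have hℓ : 0 ≤ ℓ := by
    refine Real.log_nonneg ?_
    have : 0 ≤ v₀⁻¹ * T * L ^ 2 := by positivity
    linarith
  have hy2 : y ^ 2 = α ^ 2 * ℓ := by rw [hy, mul_pow, Real.sq_sqrt hℓ]
  have hkT : (1 : ℝ) ≤ k T := by exact_mod_cast (hk1 T hT).1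
  have hscalar : (1 / 2 + 2 * (L₁ + r) / (r - ρ) * k T) * y ≤
      1 + 2 * (L₁ + r) / (r - ρ) * (k T + k T * α ^ 2 / 2 * ℓ) := by
    have hc : 1 ≤ (L₁ + r) / (r - ρ) := by rw [one_le_div hd]; linarith
    have hck : 1 ≤ (L₁ + r) / (r - ρ) * k T := one_le_mul_of_one_le_of_one_le hc hkT
    have e : 2 * (L₁ + r) / (r - ρ) * (k T + k T * α ^ 2 / 2 * ℓ) =
        (L₁ + r) / (r - ρ) * k T * (2 + y ^ 2) := by rw [hy2]; ring
    have e2 : 2 * (L₁ + r) / (r - ρ) * k T = 2 * ((L₁ + r) / (r - ρ) * k T) := by ring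
    rw [e, e2]
    -- with `c = (L₁ + r) / (r - ρ)`, the difference of the two sides is
    -- `(c k - 1) (1 - y)² + (y² - 5 / 2 * y + 2) + c k`
    nlinarith [mul_nonneg (sub_nonneg.2 hck) (sq_nonneg (1 - y)), sq_nonneg (y - 5 / 4)]
  have hRle : R + 2 * (L / (r - ρ) * L) * S ≤ L *
      (2 * C * √(v₀ + T * L ^ 2) / (α * r * L) + √T
      + 2 * (L₁ + r) / (r - ρ) * (√T * k T + √T * k T * α ^ 2 / 2 * ℓ)
      + 2 * L / (r - ρ) * S) := by
    have h1 := mul_le_mul_of_nonneg_left hscalar (mul_nonneg hL.le (Real.sqrt_nonneg (T : ℝ)))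
    have e1 : L * (2 * C * √(v₀ + T * L ^ 2) / (α * r * L)) =
        2 * C * √(v₀ + T * L ^ 2) / (α * r) := by field_simp
    rw [hR, mul_add L, mul_add L, mul_add L, e1]
    have e2 : 2 * (L / (r - ρ) * L) * S = L * (2 * L / (r - ρ) * S) := by ring
    have e3 : (L / 2 + 2 * L * (L₁ + r) / (r - ρ) * k T) * (√T * y) =
        L * √T * ((1 / 2 + 2 * (L₁ + r) / (r - ρ) * k T) * y) := by ring
    have e4 : L * √T * (1 + 2 * (L₁ + r) / (r - ρ) * (k T + k T * α ^ 2 / 2 * ℓ)) =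
        L * √T + L * (2 * (L₁ + r) / (r - ρ) * (√T * k T + √T * k T * α ^ 2 / 2 * ℓ)) := by ring
    linarith
  have h3 := mul_le_mul_of_nonneg_left (main.trans hRle)
    (show 0 ≤ r ^ 2 / (T * (r - ρ)) by positivity)
  rw [adagradBound]
  simp_rw [integral_const_mul]
  rw [← Finset.mul_sum]
  calc _ = r ^ 2 / (T * (r - ρ)) *
        ((r - ρ) * ∑ t ∈ Finset.Icc 1 T, ∫ ω, ‖θ t ω - prox (θ t ω)‖ ^ 2 ∂P) := by field_simp
    _ ≤ _ := h3
    _ = _ := by ring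

/-! ### The two output rules -/

/-- For the uniform output, independence of `τ` and the samples turns the expectation into an
average; the event `τ ∉ {1, …, T}` is null. -/
theorem IsUniformOutput.integrable_and_integral_le [IsProbabilityMeasure P]
    (hx : IsSampledFrom κ P x) {T : ℕ} (hT : 1 ≤ T) (ho : IsUniformOutput P x θ T θout)
    {q : EuclideanSpace ℝ (Fin p) → ℝ}
    (hint : ∀ t ∈ Finset.Icc 1 T, Integrable (fun ω => q (θ t ω)) P)
    (hF : ∀ t ∈ Finset.Icc 1 T, ∃ F : (Fin t → X) → ℝ, Measurable F ∧
      ∀ ω, q (θ t ω) = F (history x t ω)) :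
    Integrable (fun ω => q (θout ω)) P ∧
      ∫ ω, q (θout ω) ∂P ≤ 1 / (T : ℝ) * ∑ t ∈ Finset.Icc 1 T, ∫ ω, q (θ t ω) ∂P := by
  obtain ⟨τ, hτ, hind, hunif, hout⟩ := ho
  have hT0 : (0 : ℝ) < T := by exact_mod_cast hT
  have hset : ∀ t, MeasurableSet {ω | τ ω = t} := fun t => hτ (measurableSet_singleton t)
  have hτmem : ∀ᵐ ω ∂P, τ ω ∈ Finset.Icc 1 T := by
    have hm : MeasurableSet {ω | τ ω ∈ Finset.Icc 1 T} :=
      hτ (Finset.measurableSet (Finset.Icc 1 T))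
    have hU : {ω | τ ω ∈ Finset.Icc 1 T} = ⋃ t ∈ Finset.Icc 1 T, {ω | τ ω = t} := by
      ext ω; simp
    have hone : P.real {ω | τ ω ∈ Finset.Icc 1 T} = 1 := by
      have hdisj : Set.PairwiseDisjoint (↑(Finset.Icc 1 T)) fun t => {ω | τ ω = t} :=
        fun s _ t _ hst => Set.disjoint_left.2 fun ω (h1 : τ ω = s) (h2 : τ ω = t) =>
          hst (h1.symm.trans h2)
      rw [hU, measureReal_biUnion_finset hdisj fun t _ => hset t,
        Finset.sum_congr rfl hunif, Finset.sum_const, Nat.card_Icc, Nat.add_sub_cancel,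
        nsmul_eq_mul]
      field_simp
    rw [ae_iff]
    refine (prob_compl_eq_zero_iff hm).2 ?_
    rw [measureReal_def, ENNReal.toReal_eq_one_iff] at hone
    exact hone
  have hW : Measurable fun ω (n : ℕ) => x (n + 1) ω :=
    measurable_pi_lambda _ fun n => hx.measurable _ (by omega)
  have hprod : ∀ t ∈ Finset.Icc 1 T,
      ∫ ω, {ω | τ ω = t}.indicator (fun ω => q (θ t ω)) ω ∂P = 1 / T * ∫ ω, q (θ t ω) ∂P := by
    intro t ht
    obtain ⟨F, hFm, hFω⟩ := hF t ht
    have hF' : Measurable fun w : ℕ → X => F fun i : Fin t => w i :=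
      hFm.comp (measurable_pi_lambda _ fun i => measurable_pi_apply _)
    have h1 := hind.integral_fun_comp_mul_comp
      (f := ({t} : Set ℕ).indicator fun _ => (1 : ℝ)) (g := fun w : ℕ → X => F fun i : Fin t => w i)
      hτ.aemeasurable hW.aemeasurable (measurable_of_countable _).aestronglyMeasurable
      hF'.aestronglyMeasurable
    have e1 : ∀ ω, {ω | τ ω = t}.indicator (fun ω => q (θ t ω)) ω =
        ({t} : Set ℕ).indicator (fun _ => (1 : ℝ)) (τ ω) * F (fun i : Fin t => x (i + 1) ω) := by
      intro ω
      by_cases h : τ ω = t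
      · simp [h, hFω ω]; rfl
      · simp [h]
    have e2 : ∫ ω, ({t} : Set ℕ).indicator (fun _ => (1 : ℝ)) (τ ω) ∂P = 1 / T := by
      rw [← hunif t ht, ← integral_indicator_one (hset t)]
      rfl
    rw [integral_congr_ae (ae_of_all _ e1), h1, e2]
    congr 1
    exact integral_congr_ae (ae_of_all _ fun ω => (hFω ω).symm)
  have hind_int : ∀ t ∈ Finset.Icc 1 T,
      Integrable ({ω | τ ω = t}.indicator fun ω => q (θ t ω)) P :=
    fun t ht => (hint t ht).indicator (hset t)
  have hae : (fun ω => ∑ t ∈ Finset.Icc 1 T, {ω | τ ω = t}.indicator (fun ω => q (θ t ω)) ω)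
      =ᵐ[P] fun ω => q (θout ω) := by
    filter_upwards [hτmem] with ω hω
    refine (Finset.sum_eq_single_of_mem (τ ω) hω fun t _ hne => ?_).trans ?_
    · exact Set.indicator_of_notMem (s := {ω | τ ω = t}) (fun h : τ ω = t => hne h.symm) _
    · rw [hout ω]
      exact Set.indicator_of_mem (s := {ω' | τ ω' = τ ω}) rfl _
  refine ⟨(integrable_finsetSum _ hind_int).congr hae, le_of_eq ?_⟩
  rw [← integral_congr_ae hae, integral_finsetSum _ hind_int, Finset.sum_congr rfl hprod,
    Finset.mul_sum]

/-- The smallest of the squared gradients is at most their average. -/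
theorem IsBestOutput.integrable_and_integral_le [IsProbabilityMeasure P]
    {Φ : EuclideanSpace ℝ (Fin p) → ℝ} {T : ℕ} (hT : 1 ≤ T) (ho : IsBestOutput Φ θ T θout)
    (hm : ∀ t ∈ Finset.Icc 1 T, Measurable fun ω => ‖gradient Φ (θ t ω)‖ ^ 2)
    (hint : ∀ t ∈ Finset.Icc 1 T, Integrable (fun ω => ‖gradient Φ (θ t ω)‖ ^ 2) P) :
    Integrable (fun ω => ‖gradient Φ (θout ω)‖ ^ 2) P ∧
      ∫ ω, ‖gradient Φ (θout ω)‖ ^ 2 ∂P ≤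
        1 / (T : ℝ) * ∑ t ∈ Finset.Icc 1 T, ∫ ω, ‖gradient Φ (θ t ω)‖ ^ 2 ∂P := by
  have hT0 : (0 : ℝ) < T := by exact_mod_cast hT
  have hne : (Finset.Icc 1 T).Nonempty := ⟨1, Finset.mem_Icc.2 ⟨le_rfl, hT⟩⟩
  have hle : ∀ ω, ∀ s ∈ Finset.Icc 1 T,
      ‖gradient Φ (θout ω)‖ ^ 2 ≤ ‖gradient Φ (θ s ω)‖ ^ 2 := by
    intro ω s hs
    obtain ⟨t, -, h1, h2⟩ := ho ω
    rw [h1]; exact h2 s hs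
  have heq : (fun ω => ‖gradient Φ (θout ω)‖ ^ 2) =
      (Finset.Icc 1 T).inf' hne fun t ω => ‖gradient Φ (θ t ω)‖ ^ 2 := by
    funext ω
    rw [Finset.inf'_apply]
    refine le_antisymm (Finset.le_inf' _ _ fun s hs => hle ω s hs) ?_
    obtain ⟨t, ht, h1, -⟩ := ho ω
    rw [h1]
    exact Finset.inf'_le _ ht
  have hmeas : Measurable fun ω => ‖gradient Φ (θout ω)‖ ^ 2 := by
    rw [heq]
    exact Finset.inf'_induction hne _ (fun _ h1 _ h2 => h1.inf h2) hm
  have h1mem : 1 ∈ Finset.Icc 1 T := Finset.mem_Icc.2 ⟨le_rfl, hT⟩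
  have hi : Integrable (fun ω => ‖gradient Φ (θout ω)‖ ^ 2) P :=
    (hint 1 h1mem).mono' hmeas.aestronglyMeasurable (ae_of_all _ fun ω => by
      rw [Real.norm_eq_abs, abs_of_nonneg (sq_nonneg _)]
      exact hle ω 1 h1mem)
  refine ⟨hi, ?_⟩
  have h2 := Finset.sum_le_sum fun t ht => integral_mono hi (hint t ht) fun ω => hle ω t ht
  rw [Finset.sum_const, Nat.card_Icc, Nat.add_sub_cancel, nsmul_eq_mul] at h2
  rw [one_div, le_inv_mul_iff₀ hT0]
  exact h2

end Expectation

/-! ### The order of the bound -/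

section Order

variable {ρ r L L₁ C α v₀ : ℝ}

/-- The constant in front of the simplified rate, when the logarithm in the explicit bound is at
most `b` times the logarithmic factor of the simplified rate. -/
noncomputable def rateConst (ρ r L L₁ C α v₀ b : ℝ) : ℝ :=
  r ^ 2 * L / (r - ρ) * (2 * C * (√v₀ + L) / (α * r * L) + 1
    + 2 * (L₁ + r) / (r - ρ) * (1 + α ^ 2 / 2 * b) + 2 * L / (r - ρ))

theorem rateConst_pos (hρ : 0 < ρ) (hr : ρ < r) (hL : 0 < L) (hL₁ : 0 < L₁) (hC : 0 < C)
    (hα : 0 < α) {b : ℝ} (hb : 0 ≤ b) : 0 < rateConst ρ r L L₁ C α v₀ b := by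
  have hr0 : 0 < r := hρ.trans hr
  have hd : 0 < r - ρ := sub_pos.2 hr
  unfold rateConst
  positivity

theorem adagradBound_le (hρ : 0 < ρ) (hr : ρ < r) (hL : 0 < L) (hL₁ : 0 < L₁) (hC : 0 < C)
    (hα : 0 < α) (hv₀ : 0 < v₀) {b T k S w : ℝ} (hb : 0 ≤ b) (hT : 1 ≤ T) (hk : 1 ≤ k)
    (hS : 0 ≤ S) (hw : 1 ≤ w) (hlog : Real.log (1 + v₀⁻¹ * T * L ^ 2) ≤ b * w) :
    adagradBound ρ r L L₁ C α v₀ T k S ≤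
      rateConst ρ r L L₁ C α v₀ b * (k * w / √T + 1 / T * S) := by
  have hr0 : 0 < r := hρ.trans hr
  have hd : 0 < r - ρ := sub_pos.2 hr
  have hT0 : 0 < T := one_pos.trans_le hT
  have hs1 : 1 ≤ √T := Real.one_le_sqrt.2 hT
  have hkw : 1 ≤ k * w := one_le_mul_of_one_le_of_one_le hk hw
  have h1 : √(v₀ + T * L ^ 2) ≤ √T * (k * w) * (√v₀ + L) := by
    have i1 : √(v₀ + T * L ^ 2) ≤ √T * (√v₀ + L) := by
      rw [Real.sqrt_le_left (by positivity), mul_pow, Real.sq_sqrt hT0.le, add_sq,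
        Real.sq_sqrt hv₀.le]
      have : v₀ ≤ T * v₀ := le_mul_of_one_le_left hv₀.le hT
      have : 0 ≤ T * (2 * √v₀ * L) := by positivity
      linarith
    refine i1.trans ?_
    rw [mul_assoc]
    gcongr
    exact le_mul_of_one_le_left (by positivity) hkw
  have h2 : √T ≤ √T * (k * w) := le_mul_of_one_le_right (by positivity) hkw
  have h3 : √T * k ≤ √T * (k * w) := by
    rw [← mul_assoc]; exact le_mul_of_one_le_right (by positivity) hw
  have h4 : √T * k * α ^ 2 / 2 * Real.log (1 + v₀⁻¹ * T * L ^ 2) ≤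
      √T * (k * w) * (α ^ 2 / 2 * b) := by
    calc _ ≤ √T * k * α ^ 2 / 2 * (b * w) := by gcongr
      _ = _ := by ring
  set Q := 2 * C * (√v₀ + L) / (α * r * L) + 1 + 2 * (L₁ + r) / (r - ρ) * (1 + α ^ 2 / 2 * b)
    with hQ
  have hQ0 : 0 ≤ Q := by positivity
  set E := 2 * L / (r - ρ) with hE
  have hE0 : 0 ≤ E := by positivity
  have hbr : 2 * C * √(v₀ + T * L ^ 2) / (α * r * L) + √T
      + 2 * (L₁ + r) / (r - ρ) *
          (√T * k + √T * k * α ^ 2 / 2 * Real.log (1 + v₀⁻¹ * T * L ^ 2)) + E * S ≤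
      (Q + E) * (√T * (k * w) + S) := by
    have i1 : 2 * C * √(v₀ + T * L ^ 2) / (α * r * L) ≤
        2 * C * (√T * (k * w) * (√v₀ + L)) / (α * r * L) := by gcongr
    have i2 := mul_le_mul_of_nonneg_left (add_le_add h3 h4)
      (show 0 ≤ 2 * (L₁ + r) / (r - ρ) by positivity)
    have e : Q * (√T * (k * w)) = 2 * C * (√T * (k * w) * (√v₀ + L)) / (α * r * L)
        + √T * (k * w)
        + 2 * (L₁ + r) / (r - ρ) * (√T * (k * w) + √T * (k * w) * (α ^ 2 / 2 * b)) := by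
      rw [hQ]; ring
    have i3 : 0 ≤ Q * S := mul_nonneg hQ0 hS
    have i4 : 0 ≤ E * (√T * (k * w)) := by positivity
    linarith
  have hfin := mul_le_mul_of_nonneg_left hbr
    (show 0 ≤ r ^ 2 * L / (T * (r - ρ)) by positivity)
  refine hfin.trans (le_of_eq ?_)
  have e1 : √T * (k * w) / T = k * w / √T := by
    rw [div_eq_div_iff hT0.ne' (by positivity), mul_comm (√T), mul_assoc, Real.mul_self_sqrt hT0.le]
  rw [rateConst, ← hQ, ← hE, ← e1]
  field_simp

/-- The threshold `e / L² ≤ T` makes the logarithmic factor `log (T L²)` at least one. -/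
theorem one_le_log_and_log_le (hL : 0 < L) (hv₀ : 0 < v₀) {T : ℝ}
    (hT : Real.exp 1 / L ^ 2 ≤ T) : 1 ≤ Real.log (T * L ^ 2) ∧
      Real.log (1 + v₀⁻¹ * T * L ^ 2) ≤ (1 + Real.log (1 + v₀⁻¹)) * Real.log (T * L ^ 2) := by
  have h1 : Real.exp 1 ≤ T * L ^ 2 := (div_le_iff₀ (by positivity)).1 hT
  have h0 : 0 < T * L ^ 2 := (Real.exp_pos 1).trans_le h1
  have hw : 1 ≤ Real.log (T * L ^ 2) := (Real.le_log_iff_exp_le h0).2 h1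
  refine ⟨hw, ?_⟩
  have hv : 0 < v₀⁻¹ := inv_pos.2 hv₀
  have h2 : 1 + v₀⁻¹ * T * L ^ 2 ≤ T * L ^ 2 * (1 + v₀⁻¹) := by
    have : (1 : ℝ) ≤ T * L ^ 2 := by linarith [Real.add_one_le_exp 1]
    nlinarith
  have hpos : 0 < 1 + v₀⁻¹ * T * L ^ 2 := by
    have := mul_pos hv h0
    linarith
  have h3 := Real.log_le_log hpos h2
  rw [Real.log_mul h0.ne' (by positivity)] at h3
  have h4 : 0 ≤ Real.log (1 + v₀⁻¹) := Real.log_nonneg (by linarith)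
  nlinarith

theorem log_one_add_le (hv₀ : 0 < v₀) {T : ℝ} (hT : 1 ≤ T) :
    Real.log (1 + v₀⁻¹ * T * L ^ 2) ≤
      (1 + Real.log (1 + v₀⁻¹ * L ^ 2)) * (1 + Real.log T) := by
  have h0 : 0 ≤ v₀⁻¹ * L ^ 2 := by positivity
  have h2 : 1 + v₀⁻¹ * T * L ^ 2 ≤ T * (1 + v₀⁻¹ * L ^ 2) := by nlinarith
  have h3 := Real.log_le_log (by positivity) h2
  rw [Real.log_mul (by positivity) (by positivity)] at h3
  have h4 : 0 ≤ Real.log (1 + v₀⁻¹ * L ^ 2) := Real.log_nonneg (by linarith)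
  have h5 := Real.log_nonneg hT
  nlinarith

/-! ### Complexity under exponential mixing -/

/-- With the lags `min t k`, geometric mixing and `q ^ k ≤ 1 / T`, the mixing terms are summable
uniformly in `T`. -/
theorem sum_pow_min_le {M q : ℝ} (hM : 0 ≤ M) (hq0 : 0 < q) (hq1 : q < 1) {T k : ℕ}
    (hk : (T : ℝ) * q ^ k ≤ 1) :
    ∑ t ∈ Finset.Icc 1 T, M * q ^ min t k ≤ M * (1 / (1 - q) + 1) := by
  rw [← Finset.mul_sum]
  refine mul_le_mul_of_nonneg_left ?_ hM
  have h1 : ∀ t ∈ Finset.Icc 1 T, q ^ min t k ≤ q ^ t + q ^ k := fun t _ => by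
    rcases min_cases t k with ⟨h, -⟩ | ⟨h, -⟩ <;> rw [h]
    · linarith [pow_pos hq0 k]
    · linarith [pow_pos hq0 t]
  refine (Finset.sum_le_sum h1).trans ?_
  rw [Finset.sum_add_distrib, Finset.sum_const, Nat.card_Icc, Nat.add_sub_cancel, nsmul_eq_mul]
  refine add_le_add ?_ hk
  have hs := summable_geometric_of_lt_one hq0.le hq1
  have := hs.sum_le_tsum (Finset.Icc 1 T) fun t _ => (pow_pos hq0 t).le
  rwa [tsum_geometric_of_lt_one hq0.le hq1, ← one_div] at this

/-- The lag `⌈log T / log (1 / q)⌉ + 1` makes `q ^ k ≤ 1 / T` and is logarithmic in `T`. -/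
theorem exists_lag {q : ℝ} (hq0 : 0 < q) (hq1 : q < 1) {T : ℕ} (hT : 1 ≤ T) :
    ∃ k : ℕ, 1 ≤ k ∧ (T : ℝ) * q ^ k ≤ 1 ∧
      (k : ℝ) ≤ (2 + 1 / Real.log (1 / q)) * (1 + Real.log T) := by
  have hT1 : (1 : ℝ) ≤ T := by exact_mod_cast hT
  have hT0 : (0 : ℝ) < T := one_pos.trans_le hT1
  have hlogT := Real.log_nonneg hT1
  have hlam : 0 < Real.log (1 / q) := Real.log_pos ((one_lt_div hq0).2 hq1)
  refine ⟨⌈Real.log T / Real.log (1 / q)⌉₊ + 1, by omega, ?_, ?_⟩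
  · have h1 : Real.log T / Real.log (1 / q) ≤
        ((⌈Real.log T / Real.log (1 / q)⌉₊ + 1 : ℕ) : ℝ) := by
      push_cast
      linarith [Nat.le_ceil (Real.log T / Real.log (1 / q))]
    rw [div_le_iff₀ hlam] at h1
    refine (Real.log_nonpos_iff (by positivity)).1 ?_
    rw [Real.log_mul hT0.ne' (by positivity), Real.log_pow]
    rw [one_div, Real.log_inv] at h1 ⊢
    linarith
  · have h1 := Nat.ceil_lt_add_one (div_nonneg hlogT hlam.le)
    push_cast
    have e : Real.log T / Real.log (1 / q) = 1 / Real.log (1 / q) * Real.log T := by ring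
    have h2 : 0 < 1 / Real.log (1 / q) := by positivity
    nlinarith

/-- `(1 + log T)² / √T` falls below `ε² / H` once `T` exceeds a multiple of
`ε⁻⁴ (1 + log (1 / ε))⁴`. -/
theorem one_add_log_sq_div_sqrt_le {H ε T : ℝ} (hH : 0 < H) (hε0 : 0 < ε) (hε1 : ε ≤ 1)
    (hT : ((289 * H) ^ 4 + 1) * (1 + Real.log (1 / ε)) ^ 4 / ε ^ 4 ≤ T) :
    1 ≤ T ∧ H * (1 + Real.log T) ^ 2 / √T ≤ ε ^ 2 := by
  have hle : 0 ≤ Real.log (1 / ε) := Real.log_nonneg ((one_le_div hε0).2 hε1)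
  set l := 1 + Real.log (1 / ε) with hl
  have hl1 : 1 ≤ l := by linarith
  have hl0 : 0 < l := one_pos.trans_le hl1
  set n := T * ε ^ 4 / l ^ 4 with hn
  have hnN : (289 * H) ^ 4 + 1 ≤ n := by
    rw [hn, le_div_iff₀ (by positivity)]
    exact (div_le_iff₀ (by positivity)).1 hT
  have hn1 : 1 ≤ n := by linarith [show 0 ≤ (289 * H) ^ 4 by positivity]
  have hn0 : 0 < n := one_pos.trans_le hn1
  have hTn : T = n * (l / ε) ^ 4 := by rw [hn]; field_simp
  have hle1 : 1 ≤ l / ε := by rw [one_le_div hε0]; linarith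
  have hT1 : 1 ≤ T := by
    rw [hTn]; exact one_le_mul_of_one_le_of_one_le hn1 (one_le_pow₀ hle1)
  refine ⟨hT1, ?_⟩
  -- with `s` the eighth root of `n`, all terms become polynomial
  obtain ⟨s, hs1, hsn⟩ : ∃ s : ℝ, 1 ≤ s ∧ n = s ^ 8 := by
    refine ⟨√(√(√n)), by simp [Real.one_le_sqrt, hn1], ?_⟩
    rw [show 8 = 2 * (2 * 2) by norm_num, pow_mul, pow_mul, Real.sq_sqrt (by positivity),
      Real.sq_sqrt (by positivity), Real.sq_sqrt hn0.le]
  have hs0 : 0 < s := one_pos.trans_le hs1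
  have hsq : √T = s ^ 4 * (l / ε) ^ 2 := by
    rw [hTn, hsn, show s ^ 8 * (l / ε) ^ 4 = (s ^ 4 * (l / ε) ^ 2) ^ 2 by ring]
    exact Real.sqrt_sq (by positivity)
  have hlogT : 1 + Real.log T ≤ 17 * s * l := by
    have e : Real.log T = 8 * Real.log s + 4 * (Real.log l + Real.log (1 / ε)) := by
      rw [hTn, hsn, Real.log_mul (by positivity) (by positivity), Real.log_pow, Real.log_pow,
        div_eq_mul_one_div, Real.log_mul hl0.ne' (by positivity)]
      norm_num
    have h1 := Real.log_le_sub_one_of_pos hs0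
    have h2 := Real.log_le_sub_one_of_pos hl0
    have h3 : 8 * s + 8 * l ≤ 16 * (s * l) := by nlinarith
    have h4 : 1 ≤ s * l := one_le_mul_of_one_le_of_one_le hs1 hl1
    linarith
  have hs2 : 289 * H ≤ s ^ 2 := by
    have : (289 * H) ^ 4 ≤ (s ^ 2) ^ 4 := by rw [← pow_mul, ← hsn]; linarith
    exact le_of_pow_le_pow_left₀ four_ne_zero (by positivity) this
  have hlogT0 : 0 ≤ 1 + Real.log T := by linarith [Real.log_nonneg hT1]
  rw [hsq, div_le_iff₀ (by positivity)]
  calc H * (1 + Real.log T) ^ 2 ≤ H * (17 * s * l) ^ 2 := by gcongr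
    _ = 289 * H * (s ^ 2 * l ^ 2) := by ring
    _ ≤ s ^ 2 * (s ^ 2 * l ^ 2) := by gcongr
    _ = ε ^ 2 * (s ^ 4 * (l / ε) ^ 2) := by field_simp

end Order

/-! ### The rate for both outputs -/

section Rate

variable {p : ℕ} {X Ω : Type*} [MeasurableSpace X] [MeasurableSpace Ω] {P : Measure Ω}
  [IsProbabilityMeasure P] {π : Measure X} [IsProbabilityMeasure π]
  {κ : ∀ n : ℕ, Kernel (Fin n → X) X} [∀ n, IsMarkovKernel (κ n)]
  {ρ r L L₁ C α v₀ : ℝ} {Θ : Set (EuclideanSpace ℝ (Fin p))}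
  {f : EuclideanSpace ℝ (Fin p) → ℝ}
  {G : EuclideanSpace ℝ (Fin p) → X → EuclideanSpace ℝ (Fin p)}
  {x : ℕ → Ω → X} {θ : ℕ → Ω → EuclideanSpace ℝ (Fin p)} {v : ℕ → Ω → ℝ}
  {θout : Ω → EuclideanSpace ℝ (Fin p)}

omit [MeasurableSpace Ω] in
theorem IsAdaGrad.exists_hasGradientAt (hA : IsAdaGrad Θ G α v₀ x θ v)
    (hP : ProblemAssumptions ρ L L₁ C Θ f G π) (hρ : 0 < ρ) (hr : ρ < r) :
    ∃ prox : EuclideanSpace ℝ (Fin p) → EuclideanSpace ℝ (Fin p),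
      (∀ z, IsProxPoint Θ f r z (prox z)) ∧
      ∀ z, HasGradientAt (moreauEnvelope Θ f (1 / r)) (r • (z - prox z)) z := by
  obtain ⟨θ₁, h1, -⟩ := hA.init
  obtain ⟨prox, hp⟩ := hP.exists_prox ⟨θ₁, h1⟩ (hρ.trans hr)
  exact ⟨prox, hp, fun z => hasGradientAt_moreauEnvelope hP.weaklyConvex hρ.le hr hp z⟩

theorem IsAdaGrad.integrable_and_integral_output_le (hA : IsAdaGrad Θ G α v₀ x θ v)
    (hx : IsSampledFrom κ P x) (hP : ProblemAssumptions ρ L L₁ C Θ f G π) (hα : 0 < α)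
    (hv₀ : 0 < v₀) (hρ : 0 < ρ) (hr : ρ < r) (hL : 0 < L) (hL₁ : 0 < L₁) (hC : 0 < C)
    {T : ℕ} (hT : 1 ≤ T)
    (ho : IsUniformOutput P x θ T θout ∨
      IsBestOutput (moreauEnvelope Θ f (1 / r)) θ T θout) :
    Integrable (fun ω => ‖gradient (moreauEnvelope Θ f (1 / r)) (θout ω)‖ ^ 2) P ∧
    ∀ k : ℕ → ℕ, MonotoneOn k (Set.Ici 1) → (∀ t, 1 ≤ t → 1 ≤ k t ∧ k t ≤ t) →
      ∫ ω, ‖gradient (moreauEnvelope Θ f (1 / r)) (θout ω)‖ ^ 2 ∂P ≤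
        adagradBound ρ r L L₁ C α v₀ T (k T)
          (∑ t ∈ Finset.Icc 1 T, mixingCoeff κ π (t - k t) (t + 1)) := by
  obtain ⟨prox, hp, hgrad⟩ := hA.exists_hasGradientAt hP hρ hr
  have hr0 : 0 < r := hρ.trans hr
  have hnorm : ∀ z, ‖gradient (moreauEnvelope Θ f (1 / r)) z‖ ^ 2 = r ^ 2 * ‖z - prox z‖ ^ 2 := by
    intro z
    rw [(hgrad z).gradient, norm_smul, Real.norm_eq_abs, abs_of_pos hr0, mul_pow]
  have hint : ∀ t ∈ Finset.Icc 1 T,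
      Integrable (fun ω => ‖gradient (moreauEnvelope Θ f (1 / r)) (θ t ω)‖ ^ 2) P := by
    intro t ht
    simp_rw [hnorm]
    exact (hA.integrable_norm_sq hx hP hρ.le hr hp (Finset.mem_Icc.1 ht).1).const_mul _
  have hF : ∀ t ∈ Finset.Icc 1 T, ∃ F : (Fin t → X) → ℝ, Measurable F ∧
      ∀ ω, ‖gradient (moreauEnvelope Θ f (1 / r)) (θ t ω)‖ ^ 2 = F (history x t ω) := by
    intro t ht
    obtain ⟨F, hF, hFω⟩ := hA.exists_measurable_iterate hP t
    rw [max_eq_left (Finset.mem_Icc.1 ht).1] at hFω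
    refine ⟨fun h => r ^ 2 * ‖(F h : EuclideanSpace ℝ (Fin p)) - prox (F h)‖ ^ 2, ?_, fun ω => ?_⟩
    · exact (((continuous_residual hP.weaklyConvex hρ.le hr hp).measurable.comp
        (measurable_subtype_coe.comp hF)).norm.pow_const 2).const_mul _
    · rw [hnorm, hFω]
  have hm : ∀ t ∈ Finset.Icc 1 T,
      Measurable fun ω => ‖gradient (moreauEnvelope Θ f (1 / r)) (θ t ω)‖ ^ 2 := by
    intro t ht
    obtain ⟨F, hFm, hFω⟩ := hF t ht
    rw [funext hFω]
    exact hFm.comp (hx.measurable_history t)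
  have hout : Integrable (fun ω => ‖gradient (moreauEnvelope Θ f (1 / r)) (θout ω)‖ ^ 2) P ∧
      ∫ ω, ‖gradient (moreauEnvelope Θ f (1 / r)) (θout ω)‖ ^ 2 ∂P ≤ 1 / (T : ℝ) *
        ∑ t ∈ Finset.Icc 1 T, ∫ ω, ‖gradient (moreauEnvelope Θ f (1 / r)) (θ t ω)‖ ^ 2 ∂P := by
    rcases ho with ho | ho
    · exact ho.integrable_and_integral_le hx hT
        (q := fun z => ‖gradient (moreauEnvelope Θ f (1 / r)) z‖ ^ 2) hint hF
    · exact ho.integrable_and_integral_le hT hm hint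
  refine ⟨hout.1, fun k hk hk1 => hout.2.trans ?_⟩
  have := hA.average_le hx hP hα hv₀ hρ hr hL hL₁ hC hp hT hk hk1
  simp_rw [hnorm]
  exact this

/-- The second moment controls the mean, from `g ≤ g² / (2 ε) + ε / 2`. -/
theorem integral_le_of_integral_sq_le {g : Ω → ℝ} (hg : ∀ ω, 0 ≤ g ω)
    (hint : Integrable (fun ω => g ω ^ 2) P) {ε : ℝ} (hε : 0 < ε)
    (h : ∫ ω, g ω ^ 2 ∂P ≤ ε ^ 2) : ∫ ω, g ω ∂P ≤ ε := by
  have h1 : ∫ ω, g ω ∂P ≤ ∫ ω, (1 / (2 * ε) * g ω ^ 2 + ε / 2) ∂P := by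
    refine integral_mono_of_nonneg (ae_of_all _ hg)
      ((hint.const_mul _).add (integrable_const _)) (ae_of_all _ fun ω => ?_)
    have e : 1 / (2 * ε) * g ω ^ 2 + ε / 2 - g ω = (g ω - ε) ^ 2 / (2 * ε) := by
      field_simp; ring
    have : 0 ≤ (g ω - ε) ^ 2 / (2 * ε) := by positivity
    change g ω ≤ 1 / (2 * ε) * g ω ^ 2 + ε / 2
    linarith
  rw [integral_add (hint.const_mul _) (integrable_const _), integral_const_mul, integral_const,
    probReal_univ, one_smul] at h1
  have h2 := mul_le_mul_of_nonneg_left h (show 0 ≤ 1 / (2 * ε) by positivity)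
  have e : 1 / (2 * ε) * ε ^ 2 = ε / 2 := by field_simp
  linarith

/-- The constant in the bound of order `(1 + log T)² / √T` under mixing at rate `M q ^ k`. -/
noncomputable def mixingRateConst (ρ r L L₁ C α v₀ M q : ℝ) : ℝ :=
  rateConst ρ r L L₁ C α v₀ (1 + Real.log (1 + v₀⁻¹ * L ^ 2)) *
    (2 + 1 / Real.log (1 / q) + M * (1 / (1 - q) + 1))

theorem mixingRateConst_pos (hρ : 0 < ρ) (hr : ρ < r) (hL : 0 < L) (hL₁ : 0 < L₁) (hC : 0 < C)
    (hα : 0 < α) (hv₀ : 0 < v₀) {M q : ℝ} (hM : 0 < M) (hq0 : 0 < q) (hq1 : q < 1) :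
    0 < mixingRateConst ρ r L L₁ C α v₀ M q := by
  have h1 : 0 ≤ Real.log (1 + v₀⁻¹ * L ^ 2) := Real.log_nonneg (by
    have : 0 ≤ v₀⁻¹ * L ^ 2 := by positivity
    linarith)
  have h2 := rateConst_pos (v₀ := v₀) hρ hr hL hL₁ hC hα (add_nonneg zero_le_one h1)
  have h3 : 0 < Real.log (1 / q) := Real.log_pos ((one_lt_div hq0).2 hq1)
  have h4 : 0 < 1 - q := sub_pos.2 hq1
  unfold mixingRateConst
  positivity

omit [IsProbabilityMeasure π] [∀ n, IsMarkovKernel (κ n)] in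
/-- Optimizing the lag: with `k_t = min t K` for `K` of order `log T` the bound is of order
`(1 + log T)² / √T`. -/
theorem exists_lag_adagradBound_le (hρ : 0 < ρ) (hr : ρ < r) (hL : 0 < L) (hL₁ : 0 < L₁)
    (hC : 0 < C) (hα : 0 < α) (hv₀ : 0 < v₀) {M q : ℝ} (hM : 0 < M) (hq0 : 0 < q) (hq1 : q < 1)
    (hmix : ∀ t k : ℕ, 1 ≤ k → k ≤ t → mixingCoeff κ π (t - k) (t + 1) ≤ M * q ^ k)
    {T : ℕ} (hT : 1 ≤ T) :
    ∃ k : ℕ → ℕ, MonotoneOn k (Set.Ici 1) ∧ (∀ t, 1 ≤ t → 1 ≤ k t ∧ k t ≤ t) ∧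
      adagradBound ρ r L L₁ C α v₀ T (k T)
          (∑ t ∈ Finset.Icc 1 T, mixingCoeff κ π (t - k t) (t + 1)) ≤
        mixingRateConst ρ r L L₁ C α v₀ M q * (1 + Real.log T) ^ 2 / √T := by
  obtain ⟨K, hK1, hKq, hKle⟩ := exists_lag hq0 hq1 hT
  have hT1 : (1 : ℝ) ≤ T := by exact_mod_cast hT
  have hT0 : (0 : ℝ) < T := one_pos.trans_le hT1
  refine ⟨fun t => min t K, fun a _ b _ hab => min_le_min_right K hab,
    fun t ht => ⟨le_min ht hK1, min_le_left _ _⟩, ?_⟩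
  set S := ∑ t ∈ Finset.Icc 1 T, mixingCoeff κ π (t - min t K) (t + 1)
  have hS0 : 0 ≤ S := Finset.sum_nonneg fun t _ => mixingCoeff_nonneg κ π _ _
  have hS : S ≤ M * (1 / (1 - q) + 1) :=
    (Finset.sum_le_sum fun t ht => hmix t (min t K) (le_min (Finset.mem_Icc.1 ht).1 hK1)
      (min_le_left _ _)).trans (sum_pow_min_le hM.le hq0 hq1 hKq)
  have hlog : 0 ≤ Real.log (1 + v₀⁻¹ * L ^ 2) := Real.log_nonneg (by
    have : 0 ≤ v₀⁻¹ * L ^ 2 := by positivity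
    linarith)
  have hw : 1 ≤ 1 + Real.log T := by linarith [Real.log_nonneg hT1]
  have hk1 : (1 : ℝ) ≤ (min T K : ℕ) := by exact_mod_cast le_min hT hK1
  have hkle : ((min T K : ℕ) : ℝ) ≤ (2 + 1 / Real.log (1 / q)) * (1 + Real.log T) :=
    le_trans (by exact_mod_cast min_le_right T K) hKle
  refine (adagradBound_le hρ hr hL hL₁ hC hα hv₀ (add_nonneg zero_le_one hlog) hT1 hk1 hS0 hw
    (log_one_add_le hv₀ hT1)).trans ?_
  rw [mixingRateConst, mul_assoc, mul_div_assoc (rateConst ρ r L L₁ C α v₀ _)]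
  refine mul_le_mul_of_nonneg_left ?_
    (rateConst_pos (v₀ := v₀) hρ hr hL hL₁ hC hα (add_nonneg zero_le_one hlog)).le
  have hsq : √(T : ℝ) ≤ T := by
    rw [Real.sqrt_le_left hT0.le]; nlinarith
  have hs0 : 0 < √(T : ℝ) := Real.sqrt_pos.2 hT0
  have i1 : ((min T K : ℕ) : ℝ) * (1 + Real.log T) / √T ≤
      (2 + 1 / Real.log (1 / q)) * (1 + Real.log T) * (1 + Real.log T) / √T := by gcongr
  have i2 : 1 / (T : ℝ) * S ≤ (1 + Real.log T) ^ 2 / √T * (M * (1 / (1 - q) + 1)) := by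
    refine mul_le_mul ?_ hS hS0 (by positivity)
    exact (one_div_le_one_div_of_le hs0 hsq).trans (by gcongr; exact one_le_pow₀ hw)
  refine (add_le_add i1 i2).trans (le_of_eq ?_)
  ring

end Rate

/-! ### The theorem -/

theorem mainTheorem2 (ρ ρhat L L₁ Cφ α v₀ : ℝ) (hρ : 0 < ρ) (hρhat : ρ < ρhat) (hL : 0 < L)
    (hL₁ : 0 < L₁) (hCφ : 0 < Cφ) (hα : 0 < α) (hv₀ : 0 < v₀) :
    -- the constants below depend only on the parameters above
    -- (and `N` also on the mixing constants `M` and `r`)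
    ∃ K : ℝ, 0 < K ∧ ∃ T₀ : ℕ, ∃ N : ℝ → ℝ → ℝ, (∀ M r, 0 < N M r) ∧
    ∀ (p : ℕ) (X : Type*) [MeasurableSpace X] (Ω : Type*) [MeasurableSpace Ω]
      (P : Measure Ω) [IsProbabilityMeasure P] (π : Measure X) [IsProbabilityMeasure π]
      (κ : ∀ n : ℕ, Kernel (Fin n → X) X) [∀ n, IsMarkovKernel (κ n)]
      (Θ : Set (EuclideanSpace ℝ (Fin p))) (f : EuclideanSpace ℝ (Fin p) → ℝ)
      (G : EuclideanSpace ℝ (Fin p) → X → EuclideanSpace ℝ (Fin p))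
      (x : ℕ → Ω → X) (θ : ℕ → Ω → EuclideanSpace ℝ (Fin p)) (v : ℕ → Ω → ℝ)
      (θout : ℕ → Ω → EuclideanSpace ℝ (Fin p)),
      ProblemAssumptions ρ L L₁ Cφ Θ f G π →
      IsSampledFrom κ P x →
      IsAdaGrad Θ G α v₀ x θ v →
      (∀ T, 1 ≤ T → IsUniformOutput P x θ T (θout T) ∨
        IsBestOutput (moreauEnvelope Θ f (1 / ρhat)) θ T (θout T)) →
      -- the gradient of the Moreau envelope exists everywhere, and the expectations are finite
      Differentiable ℝ (moreauEnvelope Θ f (1 / ρhat)) ∧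
      (∀ T, 1 ≤ T → Integrable
        (fun ω => ‖gradient (moreauEnvelope Θ f (1 / ρhat)) (θout T ω)‖ ^ 2) P) ∧
      -- the explicit bound and its order
      (∀ k : ℕ → ℕ, MonotoneOn k (Set.Ici 1) → (∀ t, 1 ≤ t → 1 ≤ k t ∧ k t ≤ t) →
        ∀ T : ℕ, 1 ≤ T →
          ∫ ω, ‖gradient (moreauEnvelope Θ f (1 / ρhat)) (θout T ω)‖ ^ 2 ∂P ≤
            adagradBound ρ ρhat L L₁ Cφ α v₀ T (k T)
              (∑ t ∈ Finset.Icc 1 T, mixingCoeff κ π (t - k t) (t + 1)) ∧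
          (T₀ ≤ T →
            adagradBound ρ ρhat L L₁ Cφ α v₀ T (k T)
              (∑ t ∈ Finset.Icc 1 T, mixingCoeff κ π (t - k t) (t + 1)) ≤
            K * (k T * Real.log (T * L ^ 2) / √T
              + 1 / T * ∑ t ∈ Finset.Icc 1 T, mixingCoeff κ π (t - k t) (t + 1)))) ∧
      -- the complexity under exponential mixing
      (∀ M r : ℝ, 0 < M → 0 < r → r < 1 →
        (∀ t k : ℕ, 1 ≤ k → k ≤ t → mixingCoeff κ π (t - k) (t + 1) ≤ M * r ^ k) →
        ∀ ε : ℝ, 0 < ε → ε ≤ 1 → ∀ T : ℕ,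
          N M r * (1 + Real.log (1 / ε)) ^ 4 / ε ^ 4 ≤ T →
          ∫ ω, ‖gradient (moreauEnvelope Θ f (1 / ρhat)) (θout T ω)‖ ^ 2 ∂P ≤ ε ^ 2 ∧
          ∫ ω, ‖gradient (moreauEnvelope Θ f (1 / ρhat)) (θout T ω)‖ ∂P ≤ ε) := by
  set b := 1 + Real.log (1 + v₀⁻¹)
  have hb0 : 0 ≤ b := by
    have : 0 ≤ Real.log (1 + v₀⁻¹) := Real.log_nonneg (by linarith [inv_pos.2 hv₀])
    linarith
  -- `T₀ = ⌈e / L²⌉` ensures `log (T L²) ≥ 1`, so that it dominates all lower-order terms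
  refine ⟨rateConst ρ ρhat L L₁ Cφ α v₀ b, rateConst_pos hρ hρhat hL hL₁ hCφ hα hb0,
    ⌈Real.exp 1 / L ^ 2⌉₊,
    fun M r => (289 * mixingRateConst ρ ρhat L L₁ Cφ α v₀ M r) ^ 4 + 1,
    fun M r => by positivity, ?_⟩
  intro p X _ Ω _ P _ π _ κ _ Θ f G x θ v θout hP hx hA hout
  have hmain := fun T (hT : 1 ≤ T) =>
    hA.integrable_and_integral_output_le hx hP hα hv₀ hρ hρhat hL hL₁ hCφ hT (hout T hT)
  refine ⟨?_, fun T hT => (hmain T hT).1, ?_, ?_⟩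
  · obtain ⟨prox, -, hgrad⟩ := hA.exists_hasGradientAt hP hρ hρhat
    exact fun z => (hgrad z).differentiableAt
  · intro k hk hk1 T hT
    refine ⟨(hmain T hT).2 k hk hk1, fun hT₀ => ?_⟩
    have hlog := one_le_log_and_log_le hL hv₀ (Nat.ceil_le.1 hT₀)
    exact adagradBound_le hρ hρhat hL hL₁ hCφ hα hv₀ hb0 (by exact_mod_cast hT)
      (by exact_mod_cast (hk1 T hT).1) (Finset.sum_nonneg fun t _ => mixingCoeff_nonneg κ π _ _)
      hlog.1 hlog.2
  · intro M r hM hr0 hr1 hmix ε hε0 hε1 T hT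
    have hH := mixingRateConst_pos hρ hρhat hL hL₁ hCφ hα hv₀ hM hr0 hr1
    obtain ⟨hT1, hle⟩ := one_add_log_sq_div_sqrt_le hH hε0 hε1 hT
    have hT1' : 1 ≤ T := by exact_mod_cast hT1
    obtain ⟨k, hk, hk1, hbound⟩ :=
      exists_lag_adagradBound_le hρ hρhat hL hL₁ hCφ hα hv₀ hM hr0 hr1 hmix hT1'
    have hsq := (((hmain T hT1').2 k hk hk1).trans hbound).trans hle
    exact ⟨hsq, integral_le_of_integral_sq_le (fun _ => norm_nonneg _) (hmain T hT1').1 hε0 hsq⟩
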